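/- **Setting.** Let $\Omega\subset\mathbb R^3$ be a domain (open, connected, non-empty), $A:\Omega\to\mathbb R^3$ and $\Phi:\Omega\to\mathbb R$ smooth, $B=\nabla\times A$, and consider the motion of a charged particle $$\ddot{\boldsymbol x}=\dot{\boldsymbol x}\times B(\boldsymbol x)-\nabla\Phi(\boldsymbol x),\qquad L=\tfrac12\dot{\boldsymbol x}^2+\dot{\boldsymbol x}\cdot A-\Phi,\qquad H=\tfrac12\dot{\boldsymbol x}^2+\Phi .$$ The magnetic field is *inhomogeneous* if $B$ is not constant and *curved* if $B$ is not of constant direction. A smooth vector field $X=\xi(t,\boldsymbol x)\partial_t+\eta(t,\boldsymbol x)\cdot\partial_{\boldsymbol x}$ on $\mathbb R\times\Omega$ is a *Noether point symmetry* if $X^{(1)}L+L\,D_t\xi=D_t\sigma$ for some smooth $\sigma(t,\boldsymbol x)$, where $X^{(1)}$ is the first prolongation; the *corresponding* first integral is $I=\eta\cdot(\dot{\boldsymbol x}+A)-\xi H-\sigma$. *Involution* refers to the bracket $\{f,h\}=f_{\boldsymbol x}\cdot h_{\dot{\boldsymbol x}}-f_{\dot{\boldsymbol x}}\cdot h_{\boldsymbol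 x}+B\cdot(f_{\dot{\boldsymbol x}}\times h_{\dot{\boldsymbol x}})$ (at each fixed $t$), and *functional independence* means that the differentials on $\Omega\times\mathbb R^3$ (at each fixed $t$) are linearly independent on a dense set. *Equivalence transformations* are $$\tilde t=\epsilon_8t+\epsilon_0,\quad \tilde{\boldsymbol x}=\epsilon_7R\boldsymbol x+\boldsymbol\epsilon,\quad \tilde A=\epsilon_7\epsilon_8^{-1}RA+\nabla g,\quad \tilde\Phi=\epsilon_7^2\epsilon_8^{-2}\Phi+\epsilon_9$$ with $R\in SO(3)$, $\epsilon_7,\epsilon_8\ne0$, and $g$ an arbitrary smooth function of position. Let $\rho=\sqrt{x^2+y^2}$ and let $\phi$ be a smooth local branch of the polar angle in the $xy$-plane. The two *representative cases* are, with arbitrary smooth functions $F_1,F_2,F_3,G$: 1. (helical) $A=(xF_1-yF_2,\;yF_1+xF_2,\;F_3)$, $\Phi=G$, all functions of $(\rho,\,z-k\phi)$ with a constant $k\in\mathbb R$, where $\rho>0$; generator $x\partial_y-y\partial_x+k\partial_z$; $I=x\dot y-y\dot x+k\dot z+\rho^2F_2+kF_3$; 2. (translational) $A=(F_1,F_2,F_3)$,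 $\Phi=G$, all functions of $(x,y)$; generator $\partial_z$; $I=\dot z+F_3$. **Statement.** (a) Suppose the magnetic field is inhomogeneous and curved on $\Omega$ and the system admits a first integral $I$ that corresponds to a Noether point symmetry $X$, is functionally independent of $H$, and is in involution with $H$. Then there are an equivalence transformation (with $R$ and the $\epsilon_i$ the same on all of $\Omega$, and only the gauge function $g$ chosen locally) and constants $a\neq0$, $b$ such that one of the two cases holds: $X$ is mapped to a non-zero multiple of the generator of that case plus a constant multiple of $\partial_t$; and near every point of $\Omega$ (in case 1: every point not mapped to the $z$-axis) the potentials are mapped to potentials of that case, while $I=a\tilde I+bH$, where $\tilde I$ is the integral listed for that case, expressed in the original variables. (b) Conversely, let smooth potentials on an open set be mapped by an equivalence transformation to potentials of case 1 or case 2. Then the integral of that case, expressed in the original variables, is a first integral that corresponds to a Noether point symmetry which the transformation maps to a non-zero multiple of the generator of that case plus a constant multiple of $\partial_t$; it is functionally independent of $H$ and in involution with $H$. (c) The two cases are distinct. For no $k$ is the helical generator mapped by an equivalence transformation, on any non-empty open set, to a non-zero multiple of $\partial_z$ plus a constant multiple of $\partial_t$. For every $k$ there is a system on a domain, with inhomogeneous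 and curved magnetic field, that is equivalent to one of case 1 with this $k$ but on no non-empty open subset equivalent to one of case 2; and there is a system on a domain, with inhomogeneous and curved magnetic field, that is equivalent to one of case 2 but on no non-empty open subset equivalent to one of case 1 for any $k$. -/

import Mathlib

open scoped ContDiff Matrix

/-- Points and vectors of three-dimensional space, `x = (x 0, x 1, x 2)`. -/
abbrev Vec3 : Type := Fin 3 → ℝ

/-- Partial derivative of a function of the position. -/
noncomputable def pderiv3 (i : Fin 3) (f : Vec3 → ℝ) (x : Vec3) : ℝ :=
  fderiv ℝ f x (Pi.single i 1)

/-- Gradient. -/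
noncomputable def grad3 (f : Vec3 → ℝ) (x : Vec3) : Vec3 := fun i => pderiv3 i f x

/-- Curl. -/
noncomputable def curl3 (A : Vec3 → Vec3) (x : Vec3) : Vec3 :=
  ![pderiv3 1 (fun y => A y 2) x - pderiv3 2 (fun y => A y 1) x,
    pderiv3 2 (fun y => A y 0) x - pderiv3 0 (fun y => A y 2) x,
    pderiv3 0 (fun y => A y 1) x - pderiv3 1 (fun y => A y 0) x]

/-! ### The system -/

/-- Smooth, time-independent magnetic and electric potentials on `Ω`. -/
def SmoothPotentials (Ω : Set Vec3) (A : Vec3 → Vec3) (Φ : Vec3 → ℝ) : Prop :=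
  ContDiffOn ℝ ∞ A Ω ∧ ContDiffOn ℝ ∞ Φ Ω

/-- The magnetic field `B = ∇ × A` is inhomogeneous (not constant) and curved
(not of constant direction) on `Ω`. -/
def InhomogeneousCurved (Ω : Set Vec3) (A : Vec3 → Vec3) : Prop :=
  (¬ ∃ B₀ : Vec3, ∀ x ∈ Ω, curl3 A x = B₀) ∧
  (¬ ∃ n : Vec3, ∀ x ∈ Ω, ∃ c : ℝ, curl3 A x = c • n)

/-- `L = ẋ² / 2 + ẋ · A - Φ`. -/
noncomputable def lagrangian (A : Vec3 → Vec3) (Φ : Vec3 → ℝ) (x v : Vec3) : ℝ :=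
  (v ⬝ᵥ v) / 2 + v ⬝ᵥ A x - Φ x

/-- `H = ẋ² / 2 + Φ`. -/
noncomputable def hamiltonian (Φ : Vec3 → ℝ) (x v : Vec3) : ℝ := (v ⬝ᵥ v) / 2 + Φ x

/-- `γ`, with velocity `w`, is a solution in `Ω`, over the time set `J`, of
`ẍ = ẋ × B - ∇Φ`, `B = ∇ × A`. -/
def IsSolution (Ω : Set Vec3) (A : Vec3 → Vec3) (Φ : Vec3 → ℝ) (J : Set ℝ)
    (γ w : ℝ → Vec3) : Prop :=
  ∀ t ∈ J, γ t ∈ Ω ∧ HasDerivAt γ (w t) t ∧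
    HasDerivAt w (crossProduct (w t) (curl3 A (γ t)) - grad3 Φ (γ t)) t

/-- `I(t, x, ẋ)` is a first integral: it is constant along every solution. -/
def IsFirstIntegral (Ω : Set Vec3) (A : Vec3 → Vec3) (Φ : Vec3 → ℝ)
    (I : ℝ → Vec3 → Vec3 → ℝ) : Prop :=
  ∀ (J : Set ℝ) (γ w : ℝ → Vec3), IsOpen J → J.OrdConnected → IsSolution Ω A Φ J γ w →
    ∀ s ∈ J, ∀ t ∈ J, I s (γ s) (w s) = I t (γ t) (w t)

/-- The Poisson bracket
`{f, h} = f_x · h_ẋ - f_ẋ · h_x + B · (f_ẋ × h_ẋ)`, `B = ∇ × A`. -/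
noncomputable def poissonBracket (A : Vec3 → Vec3) (f h : Vec3 → Vec3 → ℝ) (x v : Vec3) : ℝ :=
  grad3 (fun y => f y v) x ⬝ᵥ grad3 (h x) v - grad3 (f x) v ⬝ᵥ grad3 (fun y => h y v) x
    + curl3 A x ⬝ᵥ crossProduct (grad3 (f x) v) (grad3 (h x) v)

/-- `f` and `h` are functionally independent on the phase space `Ω × ℝ³`: their differentials
are linearly independent at a dense set of points. -/
def FunctionallyIndependent (Ω : Set Vec3) (f h : Vec3 → Vec3 → ℝ) : Prop :=
  Ω ×ˢ (Set.univ : Set Vec3) ⊆ closure {q : Vec3 × Vec3 | q.1 ∈ Ω ∧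
    LinearIndependent ℝ ![(grad3 (fun y => f y q.2) q.1, grad3 (f q.1) q.2),
      (grad3 (fun y => h y q.2) q.1, grad3 (h q.1) q.2)]}

/-! ### Noether point symmetries -/

/-- A vector field `ξ(t, x) ∂_t + η(t, x) · ∂_x` on the space of `(t, x)`. -/
structure PointField where
  ξ : ℝ → Vec3 → ℝ
  η : ℝ → Vec3 → Vec3

/-- Smoothness on `ℝ × Ω`. -/
def PointField.SmoothOn (X : PointField) (Ω : Set Vec3) : Prop :=
  ContDiffOn ℝ ∞ (fun p : ℝ × Vec3 => X.ξ p.1 p.2) (Set.univ ×ˢ Ω) ∧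
  ContDiffOn ℝ ∞ (fun p : ℝ × Vec3 => X.η p.1 p.2) (Set.univ ×ˢ Ω)

/-- Total time derivative `D_t f = f_t + ẋ · ∇f` of a function of `(t, x)`. -/
noncomputable def totalDeriv (f : ℝ → Vec3 → ℝ) (t : ℝ) (x v : Vec3) : ℝ :=
  deriv (fun s => f s x) t + v ⬝ᵥ grad3 (f t) x

/-- Coefficients `D_t η^i - ẋ^i D_t ξ` of `∂_ẋ` in the first prolongation. -/
noncomputable def PointField.prolong (X : PointField) (t : ℝ) (x v : Vec3) : Vec3 :=
  fun i => totalDeriv (fun s y => X.η s y i) t x v - v i * totalDeriv X.ξ t x v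

/-- `X` is a Noether point symmetry on `Ω` with gauge function `σ(t, x)`:
`X⁽¹⁾ L + L D_t ξ = D_t σ` (the term `ξ L_t` is absent, as `L` does not depend on `t`). -/
def IsNoetherSymmetry (Ω : Set Vec3) (A : Vec3 → Vec3) (Φ : Vec3 → ℝ) (X : PointField)
    (σ : ℝ → Vec3 → ℝ) : Prop :=
  X.SmoothOn Ω ∧ ContDiffOn ℝ ∞ (fun p : ℝ × Vec3 => σ p.1 p.2) (Set.univ ×ˢ Ω) ∧
  ∀ (t : ℝ), ∀ x ∈ Ω, ∀ v : Vec3,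
    X.η t x ⬝ᵥ grad3 (fun y => lagrangian A Φ y v) x
      + X.prolong t x v ⬝ᵥ grad3 (lagrangian A Φ x) v
      + lagrangian A Φ x v * totalDeriv X.ξ t x v = totalDeriv σ t x v

/-- The Noether invariant `η · (ẋ + A) - ξ H - σ`. -/
noncomputable def noetherIntegral (A : Vec3 → Vec3) (Φ : Vec3 → ℝ) (X : PointField)
    (σ : ℝ → Vec3 → ℝ) (t : ℝ) (x v : Vec3) : ℝ :=
  X.η t x ⬝ᵥ (v + A x) - X.ξ t x * hamiltonian Φ x v - σ t x

/-- On `Ω` the system with potentials `A`, `Φ` admits `I` as a first integral that corresponds to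
the Noether point symmetry `X`, is functionally independent of `H` and in involution with `H`. -/
def AdmitsInvolutiveIntegral (Ω : Set Vec3) (A : Vec3 → Vec3) (Φ : Vec3 → ℝ) (X : PointField)
    (I : ℝ → Vec3 → Vec3 → ℝ) : Prop :=
  (∃ σ : ℝ → Vec3 → ℝ, IsNoetherSymmetry Ω A Φ X σ ∧
    ∀ (t : ℝ), ∀ x ∈ Ω, ∀ v : Vec3, I t x v = noetherIntegral A Φ X σ t x v) ∧
  IsFirstIntegral Ω A Φ I ∧
  (∀ t : ℝ, FunctionallyIndependent Ω (I t) (hamiltonian Φ)) ∧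
  (∀ (t : ℝ), ∀ x ∈ Ω, ∀ v : Vec3, poissonBracket A (I t) (hamiltonian Φ) x v = 0)

/-! ### Equivalence transformations -/

/-- The parameters of an equivalence transformation, apart from the gauge function. -/
structure EquivTransf where
  rot : Matrix (Fin 3) (Fin 3) ℝ
  rot_mem : rot ∈ Matrix.specialOrthogonalGroup (Fin 3) ℝ
  scaleX : ℝ
  scaleX_ne : scaleX ≠ 0
  scaleT : ℝ
  scaleT_ne : scaleT ≠ 0
  shiftT : ℝ
  shiftX : Vec3
  shiftΦ : ℝ

/-- Action on the time. -/
def EquivTransf.time (T : EquivTransf) (t : ℝ) : ℝ := T.scaleT * t + T.shiftT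

/-- Action on the position. -/
def EquivTransf.pos (T : EquivTransf) (x : Vec3) : Vec3 :=
  T.scaleX • (T.rot *ᵥ x) + T.shiftX

/-- Induced action on the velocity. -/
noncomputable def EquivTransf.vel (T : EquivTransf) (v : Vec3) : Vec3 :=
  (T.scaleX / T.scaleT) • (T.rot *ᵥ v)

/-- `T`, together with the gauge function `g` (a function of the new position), maps the
potentials `A`, `Φ` on `U` to the potentials `A'`, `Φ'` on the image of `U`. -/
def EquivTransf.MapsPotentials (T : EquivTransf) (g : Vec3 → ℝ) (U : Set Vec3)
    (A : Vec3 → Vec3) (Φ : Vec3 → ℝ) (A' : Vec3 → Vec3) (Φ' : Vec3 → ℝ) : Prop :=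
  ContDiffOn ℝ ∞ g (T.pos '' U) ∧
  ∀ x ∈ U,
    A' (T.pos x) = (T.scaleX / T.scaleT) • (T.rot *ᵥ A x) + grad3 g (T.pos x) ∧
    Φ' (T.pos x) = T.scaleX ^ 2 / T.scaleT ^ 2 * Φ x + T.shiftΦ

/-- `T` maps `X` on `U` to `α Y + β ∂_t` for some constants `α ≠ 0` and `β`, that is, to `Y` up
to rescaling and the generator of time translations. -/
def EquivTransf.MapsField (T : EquivTransf) (U : Set Vec3) (X Y : PointField) : Prop :=
  ∃ α β : ℝ, α ≠ 0 ∧ ∀ (t : ℝ), ∀ x ∈ U,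
    T.scaleT * X.ξ t x = α * Y.ξ (T.time t) (T.pos x) + β ∧
    T.scaleX • (T.rot *ᵥ X.η t x) = α • Y.η (T.time t) (T.pos x)

/-! ### The two representative cases -/

/-- Cylindrical radius `ρ`. -/
noncomputable def cylRadius (x : Vec3) : ℝ := √(x 0 ^ 2 + x 1 ^ 2)

/-- `φ` is a smooth branch on `V` of the polar angle in the `xy`-plane; `V` avoids the `z`-axis. -/
def IsPolarAngle (V : Set Vec3) (φ : Vec3 → ℝ) : Prop :=
  ContDiffOn ℝ ∞ φ V ∧ ∀ x ∈ V, 0 < cylRadius x ∧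
    x 0 = cylRadius x * Real.cos (φ x) ∧ x 1 = cylRadius x * Real.sin (φ x)

/-- The invariants `(u₁, u₂) = (ρ, z - k φ)`. -/
noncomputable def helicalCoords (k : ℝ) (φ : Vec3 → ℝ) (x : Vec3) : ℝ × ℝ :=
  (cylRadius x, x 2 - k * φ x)

/-- `A = (x F₁ - y F₂, y F₁ + x F₂, F₃)` and `Φ = G` on `V`, where `F₁, F₂, F₃, G` are smooth
functions of `(ρ, z - k φ)`. -/
def IsHelicalCase (k : ℝ) (V : Set Vec3) (φ : Vec3 → ℝ) (F₁ F₂ F₃ G : ℝ × ℝ → ℝ)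
    (A : Vec3 → Vec3) (Φ : Vec3 → ℝ) : Prop :=
  IsPolarAngle V φ ∧
  (∃ W : Set (ℝ × ℝ), IsOpen W ∧ (∀ x ∈ V, helicalCoords k φ x ∈ W) ∧
    ContDiffOn ℝ ∞ F₁ W ∧ ContDiffOn ℝ ∞ F₂ W ∧ ContDiffOn ℝ ∞ F₃ W ∧ ContDiffOn ℝ ∞ G W) ∧
  ∀ x ∈ V,
    A x 0 = x 0 * F₁ (helicalCoords k φ x) - x 1 * F₂ (helicalCoords k φ x) ∧
    A x 1 = x 1 * F₁ (helicalCoords k φ x) + x 0 * F₂ (helicalCoords k φ x) ∧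
    A x 2 = F₃ (helicalCoords k φ x) ∧
    Φ x = G (helicalCoords k φ x)

/-- `A = (F₁, F₂, F₃)` and `Φ = G` on `V`, where `F₁, F₂, F₃, G` are smooth functions of
`(x, y)`. -/
def IsTranslationalCase (V : Set Vec3) (F₁ F₂ F₃ G : ℝ × ℝ → ℝ)
    (A : Vec3 → Vec3) (Φ : Vec3 → ℝ) : Prop :=
  (∃ W : Set (ℝ × ℝ), IsOpen W ∧ (∀ x ∈ V, (x 0, x 1) ∈ W) ∧
    ContDiffOn ℝ ∞ F₁ W ∧ ContDiffOn ℝ ∞ F₂ W ∧ ContDiffOn ℝ ∞ F₃ W ∧ ContDiffOn ℝ ∞ G W) ∧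
  ∀ x ∈ V,
    A x 0 = F₁ (x 0, x 1) ∧ A x 1 = F₂ (x 0, x 1) ∧ A x 2 = F₃ (x 0, x 1) ∧
    Φ x = G (x 0, x 1)

/-- The helical generator `x ∂_y - y ∂_x + k ∂_z`. -/
def helicalField (k : ℝ) : PointField where
  ξ := fun _ _ => 0
  η := fun _ x => ![-x 1, x 0, k]

/-- The translational generator `∂_z`. -/
def translationalField : PointField where
  ξ := fun _ _ => 0
  η := fun _ _ => ![0, 0, 1]

/-- `x ẏ - y ẋ + k ż + (x² + y²) F₂ + k F₃`. -/
noncomputable def helicalIntegral (k : ℝ) (φ : Vec3 → ℝ) (F₂ F₃ : ℝ × ℝ → ℝ) (x v : Vec3) : ℝ :=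
  x 0 * v 1 - x 1 * v 0 + k * v 2 + (x 0 ^ 2 + x 1 ^ 2) * F₂ (helicalCoords k φ x)
    + k * F₃ (helicalCoords k φ x)

/-- `ż + F₃`. -/
def translationalIntegral (F₃ : ℝ × ℝ → ℝ) (x v : Vec3) : ℝ := v 2 + F₃ (x 0, x 1)

/-- `T`, with some gauge function, maps the potentials `A`, `Φ` on `U` to potentials of the
helical case with parameter `k`, and `I` is the helical integral of the latter, expressed in the
original variables. -/
def ReducesToHelical (T : EquivTransf) (k : ℝ) (U : Set Vec3) (A : Vec3 → Vec3) (Φ : Vec3 → ℝ)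
    (I : Vec3 → Vec3 → ℝ) : Prop :=
  ∃ (g : Vec3 → ℝ) (φ : Vec3 → ℝ) (F₁ F₂ F₃ G : ℝ × ℝ → ℝ) (A' : Vec3 → Vec3) (Φ' : Vec3 → ℝ),
    T.MapsPotentials g U A Φ A' Φ' ∧
    IsHelicalCase k (T.pos '' U) φ F₁ F₂ F₃ G A' Φ' ∧
    ∀ x ∈ U, ∀ v : Vec3, I x v = helicalIntegral k φ F₂ F₃ (T.pos x) (T.vel v)

/-- The same for the translational case. -/
def ReducesToTranslational (T : EquivTransf) (U : Set Vec3) (A : Vec3 → Vec3) (Φ : Vec3 → ℝ)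
    (I : Vec3 → Vec3 → ℝ) : Prop :=
  ∃ (g : Vec3 → ℝ) (F₁ F₂ F₃ G : ℝ × ℝ → ℝ) (A' : Vec3 → Vec3) (Φ' : Vec3 → ℝ),
    T.MapsPotentials g U A Φ A' Φ' ∧
    IsTranslationalCase (T.pos '' U) F₁ F₂ F₃ G A' Φ' ∧
    ∀ x ∈ U, ∀ v : Vec3, I x v = translationalIntegral F₃ (T.pos x) (T.vel v)

/-! The Noether condition and the condition of involution with `H` are polynomial identities in the
velocity `v`. The bracket of the Noether integral with `H` is the Noether condition stripped of all
time derivatives, so comparing the two makes `ξ`, `η` and `σ` independent of time. The coefficients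
of the involution condition then say, from degree three down to zero: `∇ξ = 0`; the Jacobian of `η`
is skew; `η` preserves `A` up to the gradient of `σ` (`PreservesPotential`); and `η · ∇Φ = 0`. This
is `noether_involution_coefficients`.

A field with skew Jacobian is a Killing field of Euclidean space, hence `η = c + w × x` on a
connected set (`exists_affine_of_skew_fderiv`, `exists_crossProduct_of_skew`). Independence of `H`
excludes `c = w = 0`. If `w = 0`, a rotation takes `c` to the `z`-axis and `η` becomes a multiple of
`∂_z`. Otherwise a rotation aligns `w` with the `z`-axis and a translation moves the screw axis onto
it, which gives the helical generator.

It remains to remove `σ` and to read off the normal form. Near a point where the normalized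
generator `Y` does not vanish there are coordinates in which `Y` is the derivative in one variable
(`StraighteningChart`). There `Y G` can be prescribed; subtracting a suitable `∇G` from `A` cancels
`σ` and makes the potentials exactly invariant (`exists_invariant_gauge`). The relevant components
are then constant along `Y`, hence functions of its two invariants.

Conversely, exactly invariant potentials are pulled back through the equivalence transformation,
gauge included, to potentials preserved up to a gradient by a nowhere vanishing Killing field, and
the Noether computation runs backwards (`admits_of_preserves`).

The cases are distinct because an equivalence transformation sends constant fields to constant
fields, while the helical generator is not constant. For the examples, any reduction forces `Φ` to
be annihilated by a constant field, or by a screw field with `w ≠ 0`; restricting this equation to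
lines gives polynomial identities that the chosen `Φ` violates. -/

/-! ### Gradients, dot products and the curl -/

theorem grad3_dotProduct (f : Vec3 → ℝ) (x v : Vec3) : grad3 f x ⬝ᵥ v = fderiv ℝ f x v := by
  conv_rhs => rw [← Finset.univ_sum_single v, map_sum]
  refine Finset.sum_congr rfl fun i _ => ?_
  rw [show (Pi.single i (v i) : Vec3) = v i • Pi.single i 1 by
    rw [← Pi.single_smul, smul_eq_mul, mul_one], map_smul, smul_eq_mul, mul_comm]
  rfl

theorem dotProduct_grad3 (f : Vec3 → ℝ) (x v : Vec3) : v ⬝ᵥ grad3 f x = fderiv ℝ f x v := by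
  rw [dotProduct_comm, grad3_dotProduct]

theorem eq_of_forall_dotProduct {a b : Vec3} (h : ∀ v, a ⬝ᵥ v = b ⬝ᵥ v) : a = b := by
  funext i
  simpa using h (Pi.single i 1)

/-- The covector `v ↦ a · v`. -/
noncomputable def dotL (a : Vec3) : Vec3 →L[ℝ] ℝ :=
  ∑ i, a i • ContinuousLinearMap.proj (R := ℝ) (φ := fun _ : Fin 3 => ℝ) i

@[simp] theorem dotL_apply (a v : Vec3) : dotL a v = a ⬝ᵥ v := by
  simp [dotL, dotProduct]

theorem grad3_eq_of_fderiv {f : Vec3 → ℝ} {x a : Vec3} (h : HasFDerivAt f (dotL a) x) :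
    grad3 f x = a :=
  eq_of_forall_dotProduct fun v => by rw [grad3_dotProduct, h.fderiv, dotL_apply]

section
variable {E : Type*} [NormedAddCommGroup E] [NormedSpace ℝ E]

theorem hasFDerivAt_dotProduct {a b : E → Vec3} {a' b' : E →L[ℝ] Vec3} {x : E}
    (ha : HasFDerivAt a a' x) (hb : HasFDerivAt b b' x) :
    HasFDerivAt (fun y => a y ⬝ᵥ b y) ((dotL (a x)).comp b' + (dotL (b x)).comp a') x := by
  have ha' := hasFDerivAt_pi'.1 ha
  have hb' := hasFDerivAt_pi'.1 hb
  have := HasFDerivAt.fun_sum (u := Finset.univ) fun i (_ : i ∈ Finset.univ) => (ha' i).mul (hb' i)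
  refine this.congr_fderiv ?_
  ext v
  simp [dotProduct, Finset.sum_add_distrib]

theorem fderiv_dotProduct {a b : E → Vec3} {x : E} (ha : DifferentiableAt ℝ a x)
    (hb : DifferentiableAt ℝ b x) (v : E) :
    fderiv ℝ (fun y => a y ⬝ᵥ b y) x v = a x ⬝ᵥ fderiv ℝ b x v + fderiv ℝ a x v ⬝ᵥ b x := by
  rw [(hasFDerivAt_dotProduct ha.hasFDerivAt hb.hasFDerivAt).fderiv]
  simp [dotProduct_comm]

theorem fderiv_component {a : E → Vec3} {x : E} (ha : DifferentiableAt ℝ a x) (i : Fin 3) (v : E) :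
    fderiv ℝ (fun y => a y i) x v = fderiv ℝ a x v i := by
  rw [((hasFDerivAt_pi'.1 ha.hasFDerivAt) i).fderiv]; rfl

end

/-- The curl is the antisymmetric part of the Jacobian: this is the exterior derivative of the
one-form `A · dx` evaluated on `a`, `b`. It lets the magnetic field be replaced by derivatives of
`A` in the bracket and in the equations of motion. -/
theorem curl3_dotProduct_crossProduct {A : Vec3 → Vec3} {x : Vec3} (hA : DifferentiableAt ℝ A x)
    (a b : Vec3) : curl3 A x ⬝ᵥ crossProduct a b
      = b ⬝ᵥ fderiv ℝ A x a - a ⬝ᵥ fderiv ℝ A x b := by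
  have key : ∀ a b : Vec3, b ⬝ᵥ fderiv ℝ A x a
      = ∑ j, b j * ∑ i, a i * pderiv3 i (fun y => A y j) x := by
    intro a b
    refine Finset.sum_congr rfl fun j _ => ?_
    rw [← fderiv_component hA, ← dotProduct_grad3]
    rfl
  rw [key, key]
  simp only [curl3, cross_apply, dotProduct, Fin.sum_univ_three, Matrix.cons_val_zero,
    Matrix.cons_val_one, Matrix.cons_val]
  ring

/-! ### Derivatives of the Hamiltonian, the Lagrangian and the Noether integral -/

theorem hasFDerivAt_hamiltonian_velocity (Φ : Vec3 → ℝ) (x v : Vec3) :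
    HasFDerivAt (hamiltonian Φ x) (dotL v) v := by
  have := ((hasFDerivAt_dotProduct (hasFDerivAt_id v) (hasFDerivAt_id v)).mul_const (1/2)).add_const
    (Φ x)
  refine (this.congr_fderiv ?_).congr_of_eventuallyEq (Filter.Eventually.of_forall fun y => ?_)
  · ext i; simp; ring
  · simp [hamiltonian]; ring

theorem grad3_hamiltonian_velocity (Φ : Vec3 → ℝ) (x v : Vec3) :
    grad3 (hamiltonian Φ x) v = v :=
  grad3_eq_of_fderiv (hasFDerivAt_hamiltonian_velocity Φ x v)

theorem fderiv_hamiltonian_position (Φ : Vec3 → ℝ) (x v : Vec3) :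
    fderiv ℝ (fun y => hamiltonian Φ y v) x = fderiv ℝ Φ x := by
  simp only [hamiltonian]; exact fderiv_const_add _

theorem grad3_lagrangian_velocity (A : Vec3 → Vec3) (Φ : Vec3 → ℝ) (x v : Vec3) :
    grad3 (lagrangian A Φ x) v = v + A x := by
  apply grad3_eq_of_fderiv
  have := (hasFDerivAt_hamiltonian_velocity Φ x v).add ((dotL (A x)).hasFDerivAt.sub_const (2 * Φ x))
  refine (this.congr_fderiv ?_).congr_of_eventuallyEq (Filter.Eventually.of_forall fun y => ?_)
  · ext i; simp
  · simp [hamiltonian, lagrangian, dotProduct_comm]; ring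

theorem fderiv_lagrangian_position {A : Vec3 → Vec3} {Φ : Vec3 → ℝ} {x : Vec3}
    (hA : DifferentiableAt ℝ A x) (hΦ : DifferentiableAt ℝ Φ x) (v w : Vec3) :
    fderiv ℝ (fun y => lagrangian A Φ y v) x w = v ⬝ᵥ fderiv ℝ A x w - fderiv ℝ Φ x w := by
  have h1 := hasFDerivAt_dotProduct (hasFDerivAt_const v x) hA.hasFDerivAt
  have := (h1.const_add ((v ⬝ᵥ v) / 2)).sub hΦ.hasFDerivAt
  have h2 : HasFDerivAt (fun y => lagrangian A Φ y v) _ x := this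
  rw [h2.fderiv]; simp

/-- The left-hand side of the Noether condition in terms of total derivatives. -/
theorem noether_lhs_eq {A : Vec3 → Vec3} {Φ : Vec3 → ℝ} {X : PointField} {t : ℝ} {x : Vec3}
    (hA : DifferentiableAt ℝ A x) (hΦ : DifferentiableAt ℝ Φ x)
    (hηt : DifferentiableAt ℝ (fun s => X.η s x) t) (hηx : DifferentiableAt ℝ (X.η t) x)
    (v : Vec3) :
    X.η t x ⬝ᵥ grad3 (fun y => lagrangian A Φ y v) x
      + X.prolong t x v ⬝ᵥ grad3 (lagrangian A Φ x) v
      + lagrangian A Φ x v * totalDeriv X.ξ t x v =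
    v ⬝ᵥ fderiv ℝ A x (X.η t x) - fderiv ℝ Φ x (X.η t x)
      + (deriv (fun s => X.η s x) t + fderiv ℝ (X.η t) x v) ⬝ᵥ (v + A x)
      - hamiltonian Φ x v * (deriv (fun s => X.ξ s x) t + fderiv ℝ (X.ξ t) x v) := by
  have hp : X.prolong t x v = (deriv (fun s => X.η s x) t + fderiv ℝ (X.η t) x v)
      - (deriv (fun s => X.ξ s x) t + fderiv ℝ (X.ξ t) x v) • v := by
    funext i
    have h1 : deriv (fun s => X.η s x i) t = deriv (fun s => X.η s x) t i := by
      rw [deriv_pi fun i => (hasDerivAt_pi.1 hηt.hasDerivAt i).differentiableAt]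
    simp only [PointField.prolong, totalDeriv, dotProduct_grad3, h1, Pi.sub_apply, Pi.add_apply,
      Pi.smul_apply, smul_eq_mul]
    rw [fderiv_component hηx]
    ring
  rw [dotProduct_grad3, fderiv_lagrangian_position hA hΦ, grad3_lagrangian_velocity, hp, totalDeriv,
    dotProduct_grad3, sub_dotProduct, smul_dotProduct, lagrangian, hamiltonian, dotProduct_add v]
  simp only [smul_eq_mul]
  ring

theorem fderiv_noetherIntegral_position {A : Vec3 → Vec3} {Φ : Vec3 → ℝ} {X : PointField}
    {σ : ℝ → Vec3 → ℝ} {t : ℝ} {x : Vec3}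
    (hA : DifferentiableAt ℝ A x) (hΦ : DifferentiableAt ℝ Φ x)
    (hη : DifferentiableAt ℝ (X.η t) x) (hξ : DifferentiableAt ℝ (X.ξ t) x)
    (hσ : DifferentiableAt ℝ (σ t) x) (v w : Vec3) :
    fderiv ℝ (fun y => noetherIntegral A Φ X σ t y v) x w =
      fderiv ℝ (X.η t) x w ⬝ᵥ (v + A x) + X.η t x ⬝ᵥ fderiv ℝ A x w
        - fderiv ℝ (X.ξ t) x w * hamiltonian Φ x v - X.ξ t x * fderiv ℝ Φ x w
        - fderiv ℝ (σ t) x w := by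
  have h1 := hasFDerivAt_dotProduct hη.hasFDerivAt (hA.hasFDerivAt.const_add v)
  have h2 := hξ.hasFDerivAt.mul (hΦ.hasFDerivAt.const_add ((v ⬝ᵥ v) / 2))
  have h3 : HasFDerivAt (fun y => noetherIntegral A Φ X σ t y v) _ x :=
    (h1.sub h2).sub hσ.hasFDerivAt
  rw [h3.fderiv]
  simp [hamiltonian]
  rw [dotProduct_comm (A x), dotProduct_comm v]
  ring

theorem grad3_noetherIntegral_velocity (A : Vec3 → Vec3) (Φ : Vec3 → ℝ) (X : PointField)
    (σ : ℝ → Vec3 → ℝ) (t : ℝ) (x v : Vec3) :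
    grad3 (noetherIntegral A Φ X σ t x) v = X.η t x - X.ξ t x • v := by
  apply grad3_eq_of_fderiv
  have h1 := (dotL (X.η t x)).hasFDerivAt.comp v ((hasFDerivAt_id v).add_const (A x))
  have h2 := (hasFDerivAt_hamiltonian_velocity Φ x v).const_mul (X.ξ t x)
  have h3 := (h1.sub h2).sub_const (σ t x)
  refine (h3.congr_fderiv ?_).congr_of_eventuallyEq (Filter.Eventually.of_forall fun y => ?_)
  · ext i; simp
  · simp [noetherIntegral]

/-- The magnetic term `B · (η × v)` exchanges `η · DA v` for `v · DA η`, and the two terms `ξ v ·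
∇Φ` cancel. What is left is the Noether condition of `noether_lhs_eq`, right-hand side subtracted,
without its time derivatives. -/
theorem poissonBracket_noetherIntegral {A : Vec3 → Vec3} {Φ : Vec3 → ℝ} {X : PointField}
    {σ : ℝ → Vec3 → ℝ} {t : ℝ} {x : Vec3}
    (hA : DifferentiableAt ℝ A x) (hΦ : DifferentiableAt ℝ Φ x)
    (hη : DifferentiableAt ℝ (X.η t) x) (hξ : DifferentiableAt ℝ (X.ξ t) x)
    (hσ : DifferentiableAt ℝ (σ t) x) (v : Vec3) :
    poissonBracket A (noetherIntegral A Φ X σ t) (hamiltonian Φ) x v =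
      fderiv ℝ (X.η t) x v ⬝ᵥ (v + A x) + v ⬝ᵥ fderiv ℝ A x (X.η t x)
        - fderiv ℝ (X.ξ t) x v * hamiltonian Φ x v - fderiv ℝ (σ t) x v
        - fderiv ℝ Φ x (X.η t x) := by
  rw [poissonBracket, grad3_hamiltonian_velocity, grad3_dotProduct,
    fderiv_noetherIntegral_position hA hΦ hη hξ hσ, grad3_noetherIntegral_velocity,
    dotProduct_grad3, fderiv_hamiltonian_position, curl3_dotProduct_crossProduct hA]
  simp only [map_sub, map_smul, sub_dotProduct, smul_dotProduct, dotProduct_sub, dotProduct_smul,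
    smul_eq_mul]
  ring

/-! ### Involutive Noether symmetries are Killing fields -/

theorem two_le_smooth : (2 : WithTop ℕ∞) ≤ ∞ := WithTop.coe_le_coe.2 le_top

theorem cubic_coeff_eq_zero {a b c d : ℝ} (h : ∀ s : ℝ, a + b * s + c * s ^ 2 + d * s ^ 3 = 0) :
    a = 0 ∧ b = 0 ∧ c = 0 ∧ d = 0 := by
  have h0 := h 0
  have h1 := h 1
  have h2 := h (-1)
  have h3 := h 2
  refine ⟨?_, ?_, ?_, ?_⟩ <;> linarith

theorem dotProduct_self_pos {v : Vec3} (hv : v ≠ 0) : 0 < v ⬝ᵥ v :=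
  lt_of_le_of_ne (Finset.sum_nonneg fun i _ => mul_self_nonneg (v i))
    fun h => hv (dotProduct_self_eq_zero.1 h.symm)

theorem exists_vec3_ne_zero : ∃ v : Vec3, v ≠ 0 := ⟨fun _ => 1, fun h => by simpa using congrFun h 0⟩

/-- Comparing the coefficients of the powers of the velocity in the Noether condition and in the
condition of involution. -/
theorem noether_involution_coefficients {a : Vec3} {DA Dη : Vec3 →L[ℝ] Vec3} {DΦ Dξ Dσ : Vec3 →L[ℝ] ℝ}
    {η ηt : Vec3} {φ ξt σt : ℝ}
    (hN : ∀ v : Vec3, v ⬝ᵥ DA η - DΦ η + (ηt + Dη v) ⬝ᵥ (v + a)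
      - ((v ⬝ᵥ v) / 2 + φ) * (ξt + Dξ v) = σt + Dσ v)
    (hB : ∀ v : Vec3, Dη v ⬝ᵥ (v + a) + v ⬝ᵥ DA η - Dξ v * ((v ⬝ᵥ v) / 2 + φ) - Dσ v - DΦ η = 0) :
    ηt = 0 ∧ ξt = 0 ∧ σt = 0 ∧ Dξ = 0 ∧ DΦ η = 0 ∧ (∀ v, Dη v ⬝ᵥ v = 0) ∧
      ∀ v, v ⬝ᵥ DA η + Dη v ⬝ᵥ a = Dσ v := by
  -- Along the ray `s • v` the difference of the two conditions is a polynomial in `s` that contains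
  -- only the time derivatives.
  have h1 : ∀ v : Vec3, ηt ⬝ᵥ a - φ * ξt - σt = 0 ∧ ηt ⬝ᵥ v = 0 ∧ -((v ⬝ᵥ v) / 2 * ξt) = 0 := by
    intro v
    have := cubic_coeff_eq_zero (a := ηt ⬝ᵥ a - φ * ξt - σt) (b := ηt ⬝ᵥ v)
      (c := -((v ⬝ᵥ v) / 2 * ξt)) (d := 0) fun s => by
        have e1 := hN (s • v)
        have e2 := hB (s • v)
        simp only [map_smul, add_dotProduct, smul_dotProduct, dotProduct_add, dotProduct_smul,
          smul_eq_mul] at e1 e2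
        linear_combination e1 - e2
    exact ⟨this.1, this.2.1, this.2.2.1⟩
  -- The involution condition alone, along the same ray, is a cubic in `s`. Its linear coefficient
  -- still carries `φ * Dξ v`, which disappears once the cubic coefficient has given `Dξ = 0`.
  have h2 : ∀ v : Vec3, DΦ η = 0 ∧ v ⬝ᵥ DA η + Dη v ⬝ᵥ a - Dσ v - φ * Dξ v = 0 ∧ Dη v ⬝ᵥ v = 0 ∧
      -(Dξ v * ((v ⬝ᵥ v) / 2)) = 0 := by
    intro v
    have := cubic_coeff_eq_zero (a := -DΦ η) (b := v ⬝ᵥ DA η + Dη v ⬝ᵥ a - Dσ v - φ * Dξ v)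
      (c := Dη v ⬝ᵥ v) (d := -(Dξ v * ((v ⬝ᵥ v) / 2))) fun s => by
        have e2 := hB (s • v)
        simp only [map_smul, smul_dotProduct, dotProduct_add, dotProduct_smul, smul_eq_mul] at e2
        linear_combination e2
    exact ⟨neg_eq_zero.1 this.1, this.2⟩
  obtain ⟨v₀, hv₀⟩ := exists_vec3_ne_zero
  have hp := dotProduct_self_pos hv₀
  have hηt : ηt = 0 := eq_of_forall_dotProduct fun v => by simpa using (h1 v).2.1
  have hξt : ξt = 0 := by
    have := (h1 v₀).2.2
    rcases mul_eq_zero.1 (neg_eq_zero.1 this) with h | h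
    · linarith
    · exact h
  have hDξ : ∀ v, Dξ v = 0 := by
    intro v
    by_cases hv : v = 0
    · simp [hv]
    · have hp := dotProduct_self_pos hv
      rcases mul_eq_zero.1 (neg_eq_zero.1 (h2 v).2.2.2) with h | h
      · exact h
      · linarith
  refine ⟨hηt, hξt, ?_, ContinuousLinearMap.ext hDξ, (h2 0).1, fun v => (h2 v).2.2.1, fun v => ?_⟩
  · have := (h1 v₀).1
    rw [hηt, hξt] at this
    simpa using this
  · have := (h2 v).2.1
    rw [hDξ] at this
    linarith

/-- The infinitesimal symmetry condition for the potentials at `x`: the vector field `η` preserves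
`A` up to the gradient of `σ`. -/
def PreservesPotential (A η : Vec3 → Vec3) (σ : Vec3 → ℝ) (x : Vec3) : Prop :=
  ∀ v : Vec3, v ⬝ᵥ fderiv ℝ A x (η x) + fderiv ℝ η x v ⬝ᵥ A x = fderiv ℝ σ x v

/-- A vector field with skew-symmetric Jacobian matrices is affine. -/
theorem exists_affine_of_skew_fderiv {Ω : Set Vec3} (hΩ : IsOpen Ω) (hc : IsConnected Ω)
    {η : Vec3 → Vec3} (hη : ContDiffOn ℝ ∞ η Ω)
    (hskew : ∀ x ∈ Ω, ∀ v, fderiv ℝ η x v ⬝ᵥ v = 0) :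
    ∃ (M : Vec3 →L[ℝ] Vec3) (c : Vec3), (∀ v, M v ⬝ᵥ v = 0) ∧ ∀ x ∈ Ω, η x = c + M x := by
  have hd := (contDiffOn_infty_iff_fderiv_of_isOpen hΩ).1 hη
  have hd2 := ((contDiffOn_infty_iff_fderiv_of_isOpen hΩ).1 hd.2).1
  have h0 : ∀ x ∈ Ω, fderiv ℝ (fderiv ℝ η) x = 0 := by
    intro x hx
    have hη' : DifferentiableAt ℝ (fderiv ℝ η) x := hd2.differentiableAt (hΩ.mem_nhds hx)
    set D := fderiv ℝ (fderiv ℝ η) x with hD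
    have hsymm : ∀ u v, D u v = D v u := by
      intro u v
      exact ((hη.contDiffAt (hΩ.mem_nhds hx)).isSymmSndFDerivAt (by simpa using two_le_smooth)) u v
    have hdiag : ∀ u v, D u v ⬝ᵥ v = 0 := by
      intro u v
      have e1 : (fun y => fderiv ℝ η y v ⬝ᵥ v) =ᶠ[nhds x] fun _ => 0 := by
        filter_upwards [hΩ.mem_nhds hx] with y hy using hskew y hy v
      have e2 := hasFDerivAt_dotProduct (hη'.hasFDerivAt.clm_apply (hasFDerivAt_const v x))
        (hasFDerivAt_const v x)
      have e3 := (e2.congr_of_eventuallyEq e1.symm).unique (hasFDerivAt_const (0:ℝ) x)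
      have := congrArg (fun f => f u) e3
      simpa [dotProduct_comm] using this
    have hanti : ∀ u v w, D u v ⬝ᵥ w = - (D u w ⬝ᵥ v) := by
      intro u v w
      have := hdiag u (v + w)
      simp only [map_add, add_dotProduct, dotProduct_add, hdiag] at this
      linarith
    -- The trilinear form `D u v ⬝ᵥ w` is symmetric in `u, v` and antisymmetric in `v, w`.
    -- Alternating the two exchanges three times returns to the same form with the opposite sign, so
    -- it vanishes.
    ext1 u; ext1 v
    refine eq_of_forall_dotProduct fun w => ?_
    have e1 := hanti u v w
    have e2 := hanti w u v
    have e3 := hanti v w u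
    rw [hsymm w u] at e2
    rw [hsymm w v] at *
    rw [hsymm v u] at e3
    simp only [zero_apply, zero_dotProduct]
    linarith
  obtain ⟨x₀, hx₀⟩ := hc.nonempty
  set M := fderiv ℝ η x₀
  have hM : ∀ x ∈ Ω, fderiv ℝ η x = M := fun x hx =>
    hΩ.is_const_of_fderiv_eq_zero hc.isPreconnected hd2 (fun y hy => h0 y hy) hx hx₀
  refine ⟨M, η x₀ - M x₀, hskew x₀ hx₀, fun x hx => ?_⟩
  have hdiff : DifferentiableOn ℝ (fun x => η x - M x) Ω := hd.1.sub M.differentiable.differentiableOn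
  have := hΩ.is_const_of_fderiv_eq_zero hc.isPreconnected hdiff (fun y hy => by
    have e := (hd.1.differentiableAt (hΩ.mem_nhds hy)).hasFDerivAt.sub M.hasFDerivAt
    rw [hM y hy] at e
    exact e.fderiv.trans (sub_self M)) hx hx₀
  rw [← sub_eq_iff_eq_add, ← this]

/-- A vector orthogonal to `M v` pairs as a cross product. -/
theorem exists_crossProduct_of_skew (M : Vec3 →L[ℝ] Vec3) (h : ∀ v, M v ⬝ᵥ v = 0) :
    ∃ w : Vec3, ∀ v, M v = crossProduct w v := by
  have hanti : ∀ v w, M v ⬝ᵥ w = - (M w ⬝ᵥ v) := by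
    intro v w
    have := h (v + w)
    simp only [map_add, add_dotProduct, dotProduct_add, h] at this
    linarith
  -- The entries of `w` are read off from `(w × e₁)₂ = w₀` and its cyclic shifts.
  refine ⟨![M (Pi.single 1 1) 2, M (Pi.single 2 1) 0, M (Pi.single 0 1) 1], fun v => ?_⟩
  have e : ∀ i j, M (Pi.single i 1) j = - M (Pi.single j 1) i := by
    intro i j
    simpa using hanti (Pi.single i 1) (Pi.single j 1)
  have hv : ∀ i, M v i = - ∑ j, M (Pi.single i 1) j * v j := by
    intro i
    have := hanti v (Pi.single i 1)
    rw [dotProduct_single_one] at this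
    exact this
  have e00 : M (Pi.single 0 1) 0 = 0 := by linarith [e 0 0]
  have e11 : M (Pi.single 1 1) 1 = 0 := by linarith [e 1 1]
  have e22 : M (Pi.single 2 1) 2 = 0 := by linarith [e 2 2]
  funext i
  rw [hv i]
  fin_cases i <;> simp [Fin.sum_univ_three, cross_apply, e00, e11, e22]
  · rw [e 0 2]; ring
  · rw [e 1 0]; ring
  · rw [e 2 1]; ring

section
variable {F : Type*} [NormedAddCommGroup F] [NormedSpace ℝ F] {Ω : Set Vec3}

theorem ContDiffOn.slice_position {f : ℝ → Vec3 → F}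
    (hf : ContDiffOn ℝ ∞ (fun p : ℝ × Vec3 => f p.1 p.2) (Set.univ ×ˢ Ω)) (t : ℝ) :
    ContDiffOn ℝ ∞ (f t) Ω :=
  hf.comp (g := fun p : ℝ × Vec3 => f p.1 p.2) (f := fun x => (t, x))
    (contDiff_prodMk_right t).contDiffOn fun _ hx => ⟨trivial, hx⟩

theorem ContDiffOn.slice_time {f : ℝ → Vec3 → F}
    (hf : ContDiffOn ℝ ∞ (fun p : ℝ × Vec3 => f p.1 p.2) (Set.univ ×ˢ Ω)) {x : Vec3} (hx : x ∈ Ω) :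
    ContDiff ℝ ∞ fun t => f t x :=
  contDiffOn_univ.1 (hf.comp (g := fun p : ℝ × Vec3 => f p.1 p.2) (f := fun t => (t, x))
    (contDiff_prodMk_left x).contDiffOn fun _ _ => ⟨trivial, hx⟩)

end

theorem ContDiffOn.differentiableAt_of_isOpen {E F : Type*} [NormedAddCommGroup E] [NormedSpace ℝ E]
    [NormedAddCommGroup F] [NormedSpace ℝ F] {f : E → F} {s : Set E} (hf : ContDiffOn ℝ ∞ f s)
    (hs : IsOpen s) {x : E} (hx : x ∈ s) : DifferentiableAt ℝ f x :=
  (hf.differentiableOn (by simp)).differentiableAt (hs.mem_nhds hx)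

theorem poissonBracket_congr {Ω : Set Vec3} (hΩ : IsOpen Ω) (A : Vec3 → Vec3)
    {f g h : Vec3 → Vec3 → ℝ} (hfg : ∀ x ∈ Ω, ∀ v, f x v = g x v) {x : Vec3} (hx : x ∈ Ω) (v : Vec3) :
    poissonBracket A f h x v = poissonBracket A g h x v := by
  have h1 : grad3 (fun y => f y v) x = grad3 (fun y => g y v) x := by
    have : (fun y => f y v) =ᶠ[nhds x] fun y => g y v := by
      filter_upwards [hΩ.mem_nhds hx] with y hy using hfg y hy v
    exact eq_of_forall_dotProduct fun w => by rw [grad3_dotProduct, grad3_dotProduct, this.fderiv_eq]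
  rw [poissonBracket, poissonBracket, h1, show f x = g x from funext (hfg x hx)]

/-- At every point, an involutive Noether integral is time-independent, and the vector field is an
infinitesimal isometry that preserves the potentials. -/
theorem involutive_noether_at {Ω : Set Vec3} (hΩ : IsOpen Ω) {A : Vec3 → Vec3} {Φ : Vec3 → ℝ}
    (hS : SmoothPotentials Ω A Φ) {X : PointField} {σ : ℝ → Vec3 → ℝ} {I : ℝ → Vec3 → Vec3 → ℝ}
    (hN : IsNoetherSymmetry Ω A Φ X σ)
    (hI : ∀ (t : ℝ), ∀ x ∈ Ω, ∀ v : Vec3, I t x v = noetherIntegral A Φ X σ t x v)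
    (hB : ∀ (t : ℝ), ∀ x ∈ Ω, ∀ v : Vec3, poissonBracket A (I t) (hamiltonian Φ) x v = 0)
    (t : ℝ) {x : Vec3} (hx : x ∈ Ω) :
    deriv (fun s => X.η s x) t = 0 ∧ deriv (fun s => X.ξ s x) t = 0 ∧
    deriv (fun s => σ s x) t = 0 ∧ fderiv ℝ (X.ξ t) x = 0 ∧ fderiv ℝ Φ x (X.η t x) = 0 ∧
    (∀ v, fderiv ℝ (X.η t) x v ⬝ᵥ v = 0) ∧ PreservesPotential A (X.η t) (σ t) x := by
  obtain ⟨⟨hξ, hη⟩, hσ, hN⟩ := hN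
  have dA := hS.1.differentiableAt_of_isOpen hΩ hx
  have dΦ := hS.2.differentiableAt_of_isOpen hΩ hx
  have dη := (hη.slice_position t).differentiableAt_of_isOpen hΩ hx
  have dξ := (hξ.slice_position t).differentiableAt_of_isOpen hΩ hx
  have dσ := (hσ.slice_position t).differentiableAt_of_isOpen hΩ hx
  have dηt := ((hη.slice_time hx).differentiable (by simp)) t
  refine noether_involution_coefficients (DA := fderiv ℝ A x) (φ := Φ x) (fun v => ?_) fun v => ?_
  · have := hN t x hx v
    rw [noether_lhs_eq dA dΦ dηt dη, totalDeriv, dotProduct_grad3] at this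
    exact this
  · have := hB t x hx v
    rw [poissonBracket_congr hΩ A (fun y hy w => hI t y hy w) hx,
      poissonBracket_noetherIntegral dA dΦ dη dξ dσ] at this
    exact this

/-- Structure of an involutive Noether integral on a domain. -/
theorem exists_killing_of_admits {Ω : Set Vec3} (hΩ : IsOpen Ω) (hc : IsConnected Ω)
    {A : Vec3 → Vec3} {Φ : Vec3 → ℝ} (hS : SmoothPotentials Ω A Φ) {X : PointField}
    {I : ℝ → Vec3 → Vec3 → ℝ} (h : AdmitsInvolutiveIntegral Ω A Φ X I) :
    ∃ (ξ₀ : ℝ) (c w : Vec3) (σ : Vec3 → ℝ), (w ≠ 0 ∨ c ≠ 0) ∧ ContDiffOn ℝ ∞ σ Ω ∧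
      ∀ x ∈ Ω, fderiv ℝ Φ x (c + crossProduct w x) = 0 ∧
        PreservesPotential A (fun y => c + crossProduct w y) σ x ∧
        ∀ t, X.ξ t x = ξ₀ ∧ X.η t x = c + crossProduct w x ∧
          ∀ v, I t x v = (c + crossProduct w x) ⬝ᵥ (v + A x) - ξ₀ * hamiltonian Φ x v - σ x := by
  obtain ⟨⟨σ, hN, hI⟩, -, hF, hB⟩ := h
  have key := fun t x (hx : x ∈ Ω) => involutive_noether_at hΩ hS hN hI hB t hx
  have hξ := hN.1.1
  have hη := hN.1.2
  have hσ := hN.2.1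
  obtain ⟨x₀, hx₀⟩ := hc.nonempty
  obtain ⟨M, c, hM, hηM⟩ := exists_affine_of_skew_fderiv hΩ hc (hη.slice_position 0)
    fun x hx => (key 0 x hx).2.2.2.2.2.1
  obtain ⟨w, hw⟩ := exists_crossProduct_of_skew M hM
  have hη0 : ∀ x ∈ Ω, X.η 0 x = c + crossProduct w x := fun x hx => by rw [hηM x hx, hw]
  have hηt : ∀ t, ∀ x ∈ Ω, X.η t x = c + crossProduct w x := fun t x hx => by
    rw [← hη0 x hx]
    exact is_const_of_deriv_eq_zero ((hη.slice_time hx).differentiable (by simp))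
      (fun s => (key s x hx).1) t 0
  have hσt : ∀ t, ∀ x ∈ Ω, σ t x = σ 0 x := fun t x hx =>
    is_const_of_deriv_eq_zero ((hσ.slice_time hx).differentiable (by simp))
      (fun s => (key s x hx).2.2.1) t 0
  have hξt : ∀ t, ∀ x ∈ Ω, X.ξ t x = X.ξ 0 x₀ := fun t x hx => by
    have e1 : X.ξ t x = X.ξ 0 x :=
      is_const_of_deriv_eq_zero ((hξ.slice_time hx).differentiable (by simp))
        (fun s => (key s x hx).2.1) t 0
    rw [e1]
    exact hΩ.is_const_of_fderiv_eq_zero hc.isPreconnected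
      ((hξ.slice_position 0).differentiableOn (by simp))
      (fun y hy => (key 0 y hy).2.2.2.1) hx hx₀
  have hIt : ∀ t, ∀ x ∈ Ω, ∀ v, I t x v
      = (c + crossProduct w x) ⬝ᵥ (v + A x) - X.ξ 0 x₀ * hamiltonian Φ x v - σ 0 x :=
    fun t x hx v => by rw [hI t x hx v, noetherIntegral, hηt t x hx, hξt t x hx, hσt t x hx]
  have hP : ∀ x ∈ Ω, PreservesPotential A (fun y => c + crossProduct w y) (σ 0) x := by
    intro x hx v
    have e : X.η 0 =ᶠ[nhds x] fun y => c + crossProduct w y := by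
      filter_upwards [hΩ.mem_nhds hx] with y hy using hη0 y hy
    have := (key 0 x hx).2.2.2.2.2.2 v
    rwa [e.fderiv_eq, hη0 x hx] at this
  refine ⟨X.ξ 0 x₀, c, w, σ 0, ?_, hσ.slice_position 0, fun x hx =>
    ⟨?_, hP x hx, fun t => ⟨hξt t x hx, hηt t x hx, hIt t x hx⟩⟩⟩
  -- If `c = w = 0`, then `PreservesPotential` gives `∇σ = 0`, so the differential of `I` is `-ξ₀`
  -- times that of `H` everywhere. The dense set of independent points is non-empty because `Ω` is,
  -- which is a contradiction.
  · by_contra! hcw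
    obtain ⟨rfl, rfl⟩ := hcw
    have hq : (x₀, (0 : Vec3)) ∈ closure _ := hF 0 ⟨hx₀, trivial⟩
    obtain ⟨⟨y, v⟩, hy, hlin⟩ := closure_nonempty_iff.1 ⟨_, hq⟩
    simp only at hy hlin
    have hσy : fderiv ℝ (σ 0) y = 0 := by
      ext u
      have := hP y hy u
      simp only [map_zero, LinearMap.zero_apply, add_zero] at this
      rw [fderiv_fun_const] at this
      simpa using this.symm
    have e1 : grad3 (fun x => I 0 x v) y = - X.ξ 0 x₀ • grad3 (fun x => hamiltonian Φ x v) y := by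
      refine eq_of_forall_dotProduct fun u => ?_
      rw [grad3_dotProduct, smul_dotProduct, grad3_dotProduct]
      have e : (fun x => I 0 x v) =ᶠ[nhds y] fun x => (-X.ξ 0 x₀) * hamiltonian Φ x v - σ 0 x := by
        filter_upwards [hΩ.mem_nhds hy] with z hz
        rw [hIt 0 z hz]; simp
      have dH : DifferentiableAt ℝ (fun x => hamiltonian Φ x v) y :=
        (hS.2.differentiableAt_of_isOpen hΩ hy).const_add _
      have dσ := (hσ.slice_position 0).differentiableAt_of_isOpen hΩ hy
      rw [e.fderiv_eq, ((dH.hasFDerivAt.const_mul _).fun_sub dσ.hasFDerivAt).fderiv, hσy]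
      simp
    have e2 : grad3 (I 0 y) v = - X.ξ 0 x₀ • grad3 (hamiltonian Φ y) v := by
      refine eq_of_forall_dotProduct fun u => ?_
      rw [grad3_dotProduct, smul_dotProduct, grad3_dotProduct]
      have e : I 0 y = fun v => (-X.ξ 0 x₀) * hamiltonian Φ y v - σ 0 y := by
        funext v
        rw [hIt 0 y hy]; simp
      have dH := hasFDerivAt_hamiltonian_velocity Φ y v
      rw [e, ((dH.const_mul _).sub_const (σ 0 y)).fderiv, dH.fderiv]
      simp
    rw [LinearIndependent.pair_iff] at hlin
    have := hlin 1 (X.ξ 0 x₀) (by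
      rw [e1, e2]; ext i <;> simp)
    exact one_ne_zero this.1
  · rw [← hη0 x hx]; exact (key 0 x hx).2.2.2.2.1

/-! ### Preservation of a vector potential up to a gradient -/

theorem grad3_contDiffOn {G : Vec3 → ℝ} {V : Set Vec3} (hV : IsOpen V) (hG : ContDiffOn ℝ ∞ G V) :
    ContDiffOn ℝ ∞ (grad3 G) V :=
  contDiffOn_pi.2 fun _ =>
    ((contDiffOn_infty_iff_fderiv_of_isOpen hV).1 hG).2.clm_apply contDiffOn_const

namespace PreservesPotential

theorem sub {A₁ A₂ η : Vec3 → Vec3} {σ₁ σ₂ : Vec3 → ℝ} {x : Vec3}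
    (h₁ : PreservesPotential A₁ η σ₁ x) (h₂ : PreservesPotential A₂ η σ₂ x)
    (dA₁ : DifferentiableAt ℝ A₁ x) (dA₂ : DifferentiableAt ℝ A₂ x)
    (dσ₁ : DifferentiableAt ℝ σ₁ x) (dσ₂ : DifferentiableAt ℝ σ₂ x) :
    PreservesPotential (fun y => A₁ y - A₂ y) η (fun y => σ₁ y - σ₂ y) x := by
  intro v
  rw [fderiv_fun_sub dA₁ dA₂, fderiv_fun_sub dσ₁ dσ₂]
  simp only [_root_.sub_apply, dotProduct_sub]
  linear_combination h₁ v - h₂ v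

/-- A vector field `η` preserves a gradient `∇G` up to the gradient of `η · ∇G`. -/
theorem grad {G : Vec3 → ℝ} {V : Set Vec3} (hV : IsOpen V) (hG : ContDiffOn ℝ ∞ G V)
    {η : Vec3 → Vec3} {x : Vec3} (hx : x ∈ V) (dη : DifferentiableAt ℝ η x) :
    PreservesPotential (grad3 G) η (fun y => fderiv ℝ G y (η y)) x := by
  intro v
  have dG' := ((contDiffOn_infty_iff_fderiv_of_isOpen hV).1 hG).2.differentiableAt_of_isOpen hV hx
  have dgrad := (grad3_contDiffOn hV hG).differentiableAt_of_isOpen hV hx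
  have hsymm : ∀ u v, fderiv ℝ (fderiv ℝ G) x u v = fderiv ℝ (fderiv ℝ G) x v u := fun u v =>
    (hG.contDiffAt (hV.mem_nhds hx)).isSymmSndFDerivAt (by simpa using two_le_smooth) u v
  have e1 : ∀ u v, v ⬝ᵥ fderiv ℝ (grad3 G) x u = fderiv ℝ (fderiv ℝ G) x u v := by
    intro u v
    have := fderiv_dotProduct (a := fun _ => v) (differentiableAt_const v) dgrad u
    simp only [dotProduct_grad3] at this
    rw [(dG'.hasFDerivAt.clm_apply (hasFDerivAt_const v x)).fderiv] at this
    simpa using this.symm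
  rw [e1, dotProduct_grad3, (dG'.hasFDerivAt.clm_apply dη.hasFDerivAt).fderiv]
  simp [hsymm v, add_comm]

/-- Pull-back along an affine map. -/
theorem pullback {A₁ A₂ η₁ η₂ : Vec3 → Vec3} {σ₂ : Vec3 → ℝ} {S : Vec3 → Vec3}
    {L L' : Vec3 →L[ℝ] Vec3} {μ ν : ℝ} {x : Vec3} (hS : ∀ y, HasFDerivAt S L y)
    (hadj : ∀ a v, L' a ⬝ᵥ v = a ⬝ᵥ L v)
    (hA : A₁ =ᶠ[nhds x] fun y => μ • L' (A₂ (S y)))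
    (hη : (fun y => L (η₁ y)) =ᶠ[nhds x] fun y => ν • η₂ (S y))
    (dA₂ : DifferentiableAt ℝ A₂ (S x)) (dη₁ : DifferentiableAt ℝ η₁ x)
    (dη₂ : DifferentiableAt ℝ η₂ (S x)) (dσ₂ : DifferentiableAt ℝ σ₂ (S x))
    (h : PreservesPotential A₂ η₂ σ₂ (S x)) :
    PreservesPotential A₁ η₁ (fun y => μ * ν * σ₂ (S y)) x := by
  intro v
  have eA : fderiv ℝ A₁ x = μ • L'.comp ((fderiv ℝ A₂ (S x)).comp L) := by
    rw [hA.fderiv_eq]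
    exact ((L'.hasFDerivAt.comp x (dA₂.hasFDerivAt.comp x (hS x))).const_smul μ).fderiv
  have eη : L (fderiv ℝ η₁ x v) = ν • fderiv ℝ η₂ (S x) (L v) := by
    have h1 := L.hasFDerivAt.comp x dη₁.hasFDerivAt
    have h2 := (dη₂.hasFDerivAt.comp x (hS x)).const_smul ν
    have := (h1.congr_of_eventuallyEq hη.symm).unique h2
    exact congrArg (fun f => f v) this
  have eσ : fderiv ℝ (fun y => μ * ν * σ₂ (S y)) x v = μ * ν * fderiv ℝ σ₂ (S x) (L v) := by
    have : HasFDerivAt (fun y => μ * ν * σ₂ (S y)) _ x :=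
      (dσ₂.hasFDerivAt.comp x (hS x)).const_mul (μ * ν)
    rw [this.fderiv]
    rfl
  have hη' : L (η₁ x) = ν • η₂ (S x) := hη.eq_of_nhds
  -- The hypothesis at `S x` is used in the direction `L v`. Moving `L'` across the dot product as
  -- the adjoint of `L` matches the two sides: `A₁` contributes the factor `μ` and the field
  -- contributes `ν`.
  rw [eA, eσ, hA.eq_of_nhds, ← h (L v)]
  simp only [_root_.smul_apply, ContinuousLinearMap.comp_apply, hη', map_smul, dotProduct_smul,
    smul_eq_mul]
  rw [dotProduct_comm v, hadj, dotProduct_comm _ (L' _), hadj, eη, dotProduct_smul, smul_eq_mul,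
    dotProduct_comm (A₂ (S x)), dotProduct_comm (L v)]
  ring

end PreservesPotential

/-! ### Geometry of the equivalence transformations -/

namespace EquivTransf
variable (T : EquivTransf)

/-- The rotation as a continuous linear map. -/
noncomputable def rotL : Vec3 →L[ℝ] Vec3 := (Matrix.mulVecLin T.rot).toContinuousLinearMap

/-- The inverse rotation as a continuous linear map. -/
noncomputable def rotInvL : Vec3 →L[ℝ] Vec3 := (Matrix.mulVecLin T.rotᵀ).toContinuousLinearMap

@[simp] theorem rotL_apply (v : Vec3) : T.rotL v = T.rot *ᵥ v := rfl

@[simp] theorem rotInvL_apply (v : Vec3) : T.rotInvL v = T.rotᵀ *ᵥ v := rfl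

theorem rot_mul_transpose : T.rot * T.rotᵀ = 1 :=
  (Matrix.mem_orthogonalGroup_iff (Fin 3) ℝ).1 (Matrix.mem_specialOrthogonalGroup_iff.1 T.rot_mem).1

theorem transpose_mul_rot : T.rotᵀ * T.rot = 1 :=
  (Matrix.mem_orthogonalGroup_iff' (Fin 3) ℝ).1 (Matrix.mem_specialOrthogonalGroup_iff.1 T.rot_mem).1

@[simp] theorem rot_transpose_mulVec (v : Vec3) : T.rot *ᵥ (T.rotᵀ *ᵥ v) = v := by
  rw [Matrix.mulVec_mulVec, rot_mul_transpose, Matrix.one_mulVec]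

@[simp] theorem transpose_rot_mulVec (v : Vec3) : T.rotᵀ *ᵥ (T.rot *ᵥ v) = v := by
  rw [Matrix.mulVec_mulVec, transpose_mul_rot, Matrix.one_mulVec]

theorem transpose_mulVec_dotProduct (a v : Vec3) : (T.rotᵀ *ᵥ a) ⬝ᵥ v = a ⬝ᵥ (T.rot *ᵥ v) := by
  rw [Matrix.mulVec_transpose, ← Matrix.dotProduct_mulVec]

theorem mulVec_dotProduct (a v : Vec3) : (T.rot *ᵥ a) ⬝ᵥ v = a ⬝ᵥ (T.rotᵀ *ᵥ v) := by
  rw [dotProduct_comm, ← transpose_mulVec_dotProduct, dotProduct_comm]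

/-- The inverse of the action on the position. -/
noncomputable def invPos (y : Vec3) : Vec3 := T.scaleX⁻¹ • (T.rotᵀ *ᵥ (y - T.shiftX))

@[simp] theorem invPos_pos (x : Vec3) : T.invPos (T.pos x) = x := by
  simp [invPos, pos, Matrix.mulVec_smul, smul_smul, T.scaleX_ne, -Matrix.mulVec_mulVec]

@[simp] theorem pos_invPos (y : Vec3) : T.pos (T.invPos y) = y := by
  simp [invPos, pos, Matrix.mulVec_smul, smul_smul, T.scaleX_ne, -Matrix.mulVec_mulVec]

theorem hasFDerivAt_pos (x : Vec3) : HasFDerivAt T.pos (T.scaleX • T.rotL) x :=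
  (T.rotL.hasFDerivAt.const_smul T.scaleX).add_const T.shiftX

theorem hasFDerivAt_invPos (x : Vec3) : HasFDerivAt T.invPos (T.scaleX⁻¹ • T.rotInvL) x := by
  have := (T.rotInvL.hasFDerivAt.comp x ((hasFDerivAt_id x).sub_const T.shiftX)).const_smul
    T.scaleX⁻¹
  exact this.congr_fderiv (by simp)

theorem contDiff_pos : ContDiff ℝ ∞ T.pos :=
  (T.rotL.contDiff.const_smul T.scaleX).add contDiff_const

theorem contDiff_invPos : ContDiff ℝ ∞ T.invPos :=
  (T.rotInvL.contDiff.comp (contDiff_id.sub contDiff_const)).const_smul T.scaleX⁻¹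

theorem image_pos (U : Set Vec3) : T.pos '' U = T.invPos ⁻¹' U :=
  congrFun (Set.image_eq_preimage_of_inverse T.invPos_pos T.pos_invPos) U

theorem isOpen_image_pos {U : Set Vec3} (hU : IsOpen U) : IsOpen (T.pos '' U) := by
  rw [image_pos]; exact hU.preimage T.contDiff_invPos.continuous

theorem image_pos_preimage (V : Set Vec3) : T.pos '' (T.pos ⁻¹' V) = V :=
  Set.image_preimage_eq V fun y => ⟨_, T.pos_invPos y⟩

end EquivTransf

/-! ### Rotating a vector to the z-axis -/

/-- The horizontal vector `(-u₁, u₀, 0)`, normalized, works unless `u` has no horizontal part, when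
the first basis vector does. It starts the orthonormal frame in `exists_rotation`. -/
theorem exists_unit_orthogonal (u : Vec3) : ∃ e : Vec3, e ⬝ᵥ e = 1 ∧ e ⬝ᵥ u = 0 := by
  by_cases h : u 0 ^ 2 + u 1 ^ 2 = 0
  · have h0 : u 0 = 0 := by nlinarith [sq_nonneg (u 0), sq_nonneg (u 1)]
    exact ⟨![1, 0, 0], by simp [dotProduct, Fin.sum_univ_three],
      by simp [dotProduct, Fin.sum_univ_three, h0]⟩
  · have hpos : 0 < u 0 ^ 2 + u 1 ^ 2 := lt_of_le_of_ne (by positivity) (Ne.symm h)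
    have hs := Real.sq_sqrt hpos.le
    have hs0 : √(u 0 ^ 2 + u 1 ^ 2) ≠ 0 := (Real.sqrt_pos.2 hpos).ne'
    refine ⟨![-u 1 / √(u 0 ^ 2 + u 1 ^ 2), u 0 / √(u 0 ^ 2 + u 1 ^ 2), 0], ?_, ?_⟩
    · simp only [dotProduct, Fin.sum_univ_three, Matrix.cons_val_zero, Matrix.cons_val_one,
        Matrix.cons_val]
      field_simp
      rw [hs]; ring
    · simp only [dotProduct, Fin.sum_univ_three, Matrix.cons_val_zero, Matrix.cons_val_one,
        Matrix.cons_val]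
      field_simp
      ring

/-- Every non-zero vector can be rotated to the positive `z`-axis. -/
theorem exists_rotation {n : Vec3} (hn : n ≠ 0) :
    ∃ R ∈ Matrix.specialOrthogonalGroup (Fin 3) ℝ, ∃ r : ℝ, r ≠ 0 ∧ R *ᵥ n = ![0, 0, r] ∧
      ∀ x, R *ᵥ crossProduct n x = r • ![-(R *ᵥ x) 1, (R *ᵥ x) 0, 0] := by
  have hp := dotProduct_self_pos hn
  obtain ⟨r, hr⟩ : ∃ r, r = √(n ⬝ᵥ n) := ⟨_, rfl⟩
  have hr2 : r * r = n ⬝ᵥ n := hr ▸ Real.mul_self_sqrt hp.le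
  have hr0 : r ≠ 0 := hr ▸ (Real.sqrt_pos.2 hp).ne'
  clear hr hp hn
  obtain ⟨u, rfl⟩ : ∃ u : Vec3, n = r • u := ⟨r⁻¹ • n, by rw [smul_smul, mul_inv_cancel₀ hr0, one_smul]⟩
  have hu : u ⬝ᵥ u = 1 := by
    simp only [smul_dotProduct, dotProduct_smul, smul_eq_mul] at hr2
    have : r * r * (u ⬝ᵥ u - 1) = 0 := by linear_combination -hr2
    rcases mul_eq_zero.1 this with h | h
    · exact absurd h (mul_ne_zero hr0 hr0)
    · linarith
  obtain ⟨e, he, heu⟩ := exists_unit_orthogonal u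
  simp only [dotProduct, Fin.sum_univ_three] at hu he heu
  -- The rows `e`, `u × e`, `u` form a right-handed orthonormal frame, so the matrix is a rotation.
  -- It takes `u` to the third basis vector and conjugates `u × ·` to the infinitesimal rotation
  -- about the `z`-axis.
  refine ⟨Matrix.of ![e, crossProduct u e, u], ?_, r, hr0, ?_, fun x => ?_⟩
  · rw [Matrix.mem_specialOrthogonalGroup_iff, Matrix.mem_orthogonalGroup_iff]
    constructor
    · ext i j
      fin_cases i <;> fin_cases j <;>
        simp [Matrix.mul_apply, Fin.sum_univ_three, cross_apply] <;> grind
    · rw [Matrix.det_fin_three]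
      simp [cross_apply]
      grind
  · funext i
    fin_cases i <;> simp [Matrix.mulVec, dotProduct, Fin.sum_univ_three, cross_apply] <;> grind
  · funext i
    fin_cases i <;> simp [Matrix.mulVec, dotProduct, Fin.sum_univ_three, cross_apply] <;> grind

/-! ### Smooth dependence of integrals on parameters -/

section ParametricIntegral

variable {E : Type} [NormedAddCommGroup E] [NormedSpace ℝ E]

/-- Differentiation under the integral sign; the dominating constant comes from compactness of the
unit interval and continuity of the derivative. -/
theorem hasFDerivAt_integral_unitInterval {F : Type} [NormedAddCommGroup F] [NormedSpace ℝ F]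
    {f : E × ℝ → F} {W : Set (E × ℝ)} (hW : IsOpen W) (hf : ContDiffOn ℝ ∞ f W) {U : Set E}
    (hU : IsOpen U) (hUW : ∀ x ∈ U, ∀ t ∈ Set.Icc (0 : ℝ) 1, (x, t) ∈ W) {x : E} (hx : x ∈ U) :
    HasFDerivAt (fun x => ∫ t in (0 : ℝ)..1, f (x, t))
      (∫ t in (0 : ℝ)..1, (fderiv ℝ f (x, t)).comp (ContinuousLinearMap.inl ℝ E ℝ)) x := by
  have hsub : Set.uIoc (0 : ℝ) 1 ⊆ Set.Icc 0 1 := by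
    rw [Set.uIoc_of_le zero_le_one]; exact Set.Ioc_subset_Icc_self
  have hf' : ContinuousOn (fderiv ℝ f) W :=
    ((contDiffOn_infty_iff_fderiv_of_isOpen hW).1 hf).2.continuousOn
  have hslice : ∀ y ∈ U, ContinuousOn (fun t : ℝ => (y, t)) (Set.Icc 0 1) := fun y _ => by fun_prop
  have hf'x : ContinuousOn (fun t : ℝ => fderiv ℝ f (x, t)) (Set.Icc 0 1) :=
    hf'.comp (hslice x hx) fun t ht => hUW x hx t ht
  obtain ⟨C, hC⟩ := isCompact_Icc.exists_bound_of_continuousOn hf'x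
  -- `C` bounds the derivative only on the slice over `x`. By continuity the weaker bound `C + 1`
  -- holds near each point of that slice, and compactness makes the neighbourhood of `x` uniform in
  -- `t`.
  have hev : ∀ᶠ y in nhds x, ∀ t ∈ Set.Icc (0 : ℝ) 1, y ∈ U ∧ ‖fderiv ℝ f (y, t)‖ ≤ C + 1 := by
    refine isCompact_Icc.eventually_forall_of_forall_eventually fun t ht => ?_
    have hc := (hf'.continuousAt (hW.mem_nhds (hUW x hx t ht))).norm
    have h1 := hc.eventually (Iio_mem_nhds (show ‖fderiv ℝ f (x, t)‖ < C + 1 by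
      linarith [hC t ht]))
    have h2 : ∀ᶠ p : E × ℝ in nhds (x, t), p.1 ∈ U :=
      continuous_fst.continuousAt.eventually (hU.mem_nhds hx)
    filter_upwards [h1, h2] with p hp hp2 using ⟨hp2, hp.le⟩
  have hmeas : ∀ y ∈ U, MeasureTheory.AEStronglyMeasurable (fun t => f (y, t))
      (MeasureTheory.volume.restrict (Set.uIoc (0 : ℝ) 1)) := fun y hy =>
    ((hf.continuousOn.comp (hslice y hy) fun t ht => hUW y hy t ht).mono
      hsub).aestronglyMeasurable measurableSet_uIoc
  have hcont' : ContinuousOn (fun t : ℝ => (fderiv ℝ f (x, t)).comp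
      (ContinuousLinearMap.inl ℝ E ℝ)) (Set.Icc 0 1) := hf'x.clm_comp continuousOn_const
  refine intervalIntegral.hasFDerivAt_integral_of_dominated_of_fderiv_le
    (F := fun x t => f (x, t))
    (F' := fun x t => (fderiv ℝ f (x, t)).comp (ContinuousLinearMap.inl ℝ E ℝ))
    (bound := fun _ => (C + 1) * ‖ContinuousLinearMap.inl ℝ E ℝ‖) hev ?_ ?_ ?_ ?_ ?_ ?_
  · filter_upwards [hU.mem_nhds hx] with y hy using hmeas y hy
  · refine ContinuousOn.intervalIntegrable ?_
    rw [Set.uIcc_of_le zero_le_one]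
    exact hf.continuousOn.comp (hslice x hx) fun t ht => hUW x hx t ht
  · exact (hcont'.mono hsub).aestronglyMeasurable measurableSet_uIoc
  · refine Filter.Eventually.of_forall fun t ht y hy => ?_
    refine (ContinuousLinearMap.opNorm_comp_le _ _).trans ?_
    exact mul_le_mul_of_nonneg_right (hy t (hsub ht)).2 (norm_nonneg _)
  · exact intervalIntegrable_const
  · refine Filter.Eventually.of_forall fun t ht y hy => ?_
    have hd := hf.differentiableOn (by simp) |>.differentiableAt
      (hW.mem_nhds (hUW y (hy t (hsub ht)).1 t (hsub ht)))
    exact hd.hasFDerivAt.comp y (hasFDerivAt_prodMk_left y t)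

/-- The derivative of the integral is again such an integral, with values in `E →L[ℝ] F`. The
induction therefore needs the target space quantified inside, and `E` and `F` in the same universe.
-/
theorem contDiffOn_integral_unitInterval_nat (n : ℕ) : ∀ {F : Type} [NormedAddCommGroup F]
    [NormedSpace ℝ F] {f : E × ℝ → F} {W : Set (E × ℝ)} (_ : IsOpen W)
    (_ : ContDiffOn ℝ ∞ f W) {U : Set E} (_ : IsOpen U)
    (_ : ∀ x ∈ U, ∀ t ∈ Set.Icc (0 : ℝ) 1, (x, t) ∈ W),
    ContDiffOn ℝ n (fun x => ∫ t in (0 : ℝ)..1, f (x, t)) U := by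
  induction n with
  | zero =>
    intro F _ _ f W hW hf U hU hUW
    refine contDiffOn_zero.2 fun x hx => ?_
    exact (hasFDerivAt_integral_unitInterval hW hf hU hUW hx).continuousAt.continuousWithinAt
  | succ n ih =>
    intro F _ _ f W hW hf U hU hUW
    have hd := fun x (hx : x ∈ U) => hasFDerivAt_integral_unitInterval hW hf hU hUW hx
    push_cast
    refine (contDiffOn_succ_iff_fderiv_of_isOpen hU).2
      ⟨fun x hx => (hd x hx).differentiableAt.differentiableWithinAt, by simp, ?_⟩
    have hf' := ((contDiffOn_infty_iff_fderiv_of_isOpen hW).1 hf).2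
    exact (ih hW (f := fun p => (fderiv ℝ f p).comp (ContinuousLinearMap.inl ℝ E ℝ))
      (hf'.clm_comp contDiffOn_const) hU hUW).congr fun x hx => (hd x hx).fderiv

/-- Integrals over the unit interval depend smoothly on parameters. -/
theorem contDiffOn_integral_unitInterval {F : Type} [NormedAddCommGroup F] [NormedSpace ℝ F]
    {f : E × ℝ → F} {W : Set (E × ℝ)} (hW : IsOpen W) (hf : ContDiffOn ℝ ∞ f W) {U : Set E}
    (hU : IsOpen U) (hUW : ∀ x ∈ U, ∀ t ∈ Set.Icc (0 : ℝ) 1, (x, t) ∈ W) :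
    ContDiffOn ℝ ∞ (fun x => ∫ t in (0 : ℝ)..1, f (x, t)) U :=
  contDiffOn_infty.2 fun n => contDiffOn_integral_unitInterval_nat n hW hf hU hUW

end ParametricIntegral

/-! ### Straightening charts -/

/-- Coordinates `(inv, time)` on `V`, with values in `W × (t₀ - δ, t₀ + δ)`, in which the vector
field `Y` is the derivative in the last coordinate. -/
structure StraighteningChart (Y : Vec3 → Vec3) (V : Set Vec3) (inv : Vec3 → ℝ × ℝ)
    (W : Set (ℝ × ℝ)) where
  param : (ℝ × ℝ) × ℝ → Vec3
  time : Vec3 → ℝ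
  t₀ : ℝ
  δ : ℝ
  pos : 0 < δ
  isOpen : IsOpen V
  isOpen_inv : IsOpen W
  contDiff_param : ContDiff ℝ ∞ param
  contDiffOn_inv : ContDiffOn ℝ ∞ inv V
  contDiffOn_time : ContDiffOn ℝ ∞ time V
  inv_mem : ∀ y ∈ V, inv y ∈ W
  time_mem : ∀ y ∈ V, time y ∈ Metric.ball t₀ δ
  param_inv : ∀ y ∈ V, param (inv y, time y) = y
  param_mem : ∀ w ∈ W, ∀ s ∈ Metric.ball t₀ δ, param (w, s) ∈ V
  inv_param : ∀ w ∈ W, ∀ s ∈ Metric.ball t₀ δ, inv (param (w, s)) = w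
  time_param : ∀ w ∈ W, ∀ s ∈ Metric.ball t₀ δ, time (param (w, s)) = s
  hasDerivAt_param : ∀ w s, HasDerivAt (fun r => param (w, r)) (Y (param (w, s))) s

namespace StraighteningChart

variable {Y : Vec3 → Vec3} {V : Set Vec3} {inv : Vec3 → ℝ × ℝ} {W : Set (ℝ × ℝ)}

theorem hasDerivAt_comp_param (c : StraighteningChart Y V inv W) {f : Vec3 → ℝ}
    (hf : ContDiffOn ℝ ∞ f V) {w : ℝ × ℝ} (hw : w ∈ W) {s : ℝ} (hs : s ∈ Metric.ball c.t₀ c.δ) :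
    HasDerivAt (fun r => f (c.param (w, r)))
      (fderiv ℝ f (c.param (w, s)) (Y (c.param (w, s)))) s :=
  (hf.differentiableAt_of_isOpen c.isOpen (c.param_mem w hw s hs)).hasFDerivAt.comp_hasDerivAt s
    (c.hasDerivAt_param w s)

/-- Functions that are constant along `Y` are functions of the invariants. -/
theorem exists_factor (c : StraighteningChart Y V inv W) {f : Vec3 → ℝ}
    (hf : ContDiffOn ℝ ∞ f V) (hY : ∀ y ∈ V, fderiv ℝ f y (Y y) = 0) :
    ∃ F : ℝ × ℝ → ℝ, ContDiffOn ℝ ∞ F W ∧ ∀ y ∈ V, f y = F (inv y) := by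
  have h0 : c.t₀ ∈ Metric.ball c.t₀ c.δ := Metric.mem_ball_self c.pos
  -- `F` is `f` evaluated where the orbit with invariants `w` meets the slice `time = t₀`.
  refine ⟨fun w => f (c.param (w, c.t₀)), ?_, fun y hy => ?_⟩
  · exact hf.comp (c.contDiff_param.comp (contDiff_prodMk_left c.t₀)).contDiffOn
      fun w hw => c.param_mem w hw _ h0
  · have hd := fun s hs => c.hasDerivAt_comp_param hf (c.inv_mem y hy) (s := s) hs
    have := Metric.isOpen_ball.is_const_of_deriv_eq_zero
      (convex_ball c.t₀ c.δ).isPreconnected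
      (fun s hs => (hd s hs).differentiableAt.differentiableWithinAt)
      (fun s hs => by
        rw [(hd s hs).deriv]
        exact hY _ (c.param_mem _ (c.inv_mem y hy) s hs)) (c.time_mem y hy) h0
    simp only [c.param_inv y hy] at this
    exact this

/-- The equation `Y G = f` has smooth solutions. -/
theorem exists_primitive (c : StraighteningChart Y V inv W) {f : Vec3 → ℝ}
    (hf : ContDiffOn ℝ ∞ f V) :
    ∃ G : Vec3 → ℝ, ContDiffOn ℝ ∞ G V ∧ ∀ y ∈ V, fderiv ℝ G y (Y y) = f y := by
  have h0 : c.t₀ ∈ Metric.ball c.t₀ c.δ := Metric.mem_ball_self c.pos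
  -- `K` is the integral of `f` along the orbit from time `t₀` to time `q.2`. Rescaling to the unit
  -- interval turns the variable endpoint into a parameter, so that
  -- `contDiffOn_integral_unitInterval` applies.
  let K : (ℝ × ℝ) × ℝ → ℝ := fun q =>
    (q.2 - c.t₀) * ∫ t in (0 : ℝ)..1, f (c.param (q.1, c.t₀ + (q.2 - c.t₀) * t))
  have hK : ContDiffOn ℝ ∞ K (W ×ˢ Metric.ball c.t₀ c.δ) := by
    have hmap : ContDiff ℝ ∞ fun p : ((ℝ × ℝ) × ℝ) × ℝ =>
        (p.1.1, c.t₀ + (p.1.2 - c.t₀) * p.2) := by fun_prop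
    refine (contDiff_snd.sub contDiff_const).contDiffOn.mul
      (contDiffOn_integral_unitInterval
        (f := fun p : ((ℝ × ℝ) × ℝ) × ℝ => f (c.param (p.1.1, c.t₀ + (p.1.2 - c.t₀) * p.2)))
        (W := (fun p : ((ℝ × ℝ) × ℝ) × ℝ => (p.1.1, c.t₀ + (p.1.2 - c.t₀) * p.2)) ⁻¹'
          (W ×ˢ Metric.ball c.t₀ c.δ))
        ((c.isOpen_inv.prod Metric.isOpen_ball).preimage hmap.continuous)
        (hf.comp (c.contDiff_param.comp hmap).contDiffOn
          fun p hp => c.param_mem _ hp.1 _ hp.2)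
        (c.isOpen_inv.prod Metric.isOpen_ball) ?_)
    rintro ⟨w, s⟩ ⟨hw, hs⟩ t ht
    refine ⟨hw, ?_⟩
    have := (convex_ball c.t₀ c.δ).add_smul_sub_mem h0 hs ht
    simpa [mul_comm] using this
  have hmaps : ∀ y ∈ V, (inv y, c.time y) ∈ W ×ˢ Metric.ball c.t₀ c.δ :=
    fun y hy => ⟨c.inv_mem y hy, c.time_mem y hy⟩
  have hG : ContDiffOn ℝ ∞ (fun y => K (inv y, c.time y)) V :=
    hK.comp (c.contDiffOn_inv.prodMk c.contDiffOn_time) hmaps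
  refine ⟨_, hG, fun y hy => ?_⟩
  have hw := c.inv_mem y hy
  have hs := c.time_mem y hy
  have h1 := c.hasDerivAt_comp_param hG hw hs
  rw [c.param_inv y hy] at h1
  have hcont : ContinuousOn (fun r => f (c.param (inv y, r))) (Metric.ball c.t₀ c.δ) :=
    fun r hr => (c.hasDerivAt_comp_param hf hw hr).continuousAt.continuousWithinAt
  have h2 : HasDerivAt (fun s => ∫ r in c.t₀..s, f (c.param (inv y, r)))
      (f (c.param (inv y, c.time y))) (c.time y) := by
    have hsub : Set.uIcc c.t₀ (c.time y) ⊆ Metric.ball c.t₀ c.δ :=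
      (convex_ball c.t₀ c.δ).ordConnected.uIcc_subset h0 hs
    exact intervalIntegral.integral_hasDerivAt_right (hcont.mono hsub).intervalIntegrable
      (hcont.stronglyMeasurableAtFilter Metric.isOpen_ball _ hs)
      (hcont.continuousAt (Metric.isOpen_ball.mem_nhds hs))
  rw [c.param_inv y hy] at h2
  -- Along the orbit the primitive coincides with the unscaled integral, whose derivative is given
  -- by the fundamental theorem of calculus.
  refine h1.unique (h2.congr_of_eventuallyEq ?_)
  filter_upwards [Metric.isOpen_ball.mem_nhds hs] with s hs'
  simp only [c.inv_param _ hw s hs', c.time_param _ hw s hs', K]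
  rw [intervalIntegral.mul_integral_comp_add_mul (f := fun r => f (c.param (inv y, r)))]
  simp

end StraighteningChart

/-! ### Polar angles -/

/-- The half-space of points whose polar angle differs from `a` by less than a right angle. -/
def polarHalfSpace (a : ℝ) : Set Vec3 := {y | 0 < Real.cos a * y 0 + Real.sin a * y 1}

/-- The branch of the polar angle on `polarHalfSpace a` with values near `a`. -/
noncomputable def polarBranch (a : ℝ) (y : Vec3) : ℝ :=
  a + Real.arctan ((Real.cos a * y 1 - Real.sin a * y 0) / (Real.cos a * y 0 + Real.sin a * y 1))

theorem isOpen_polarHalfSpace (a : ℝ) : IsOpen (polarHalfSpace a) :=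
  isOpen_lt continuous_const (by fun_prop)

theorem isPolarAngle_polarBranch (a : ℝ) : IsPolarAngle (polarHalfSpace a) (polarBranch a) := by
  refine ⟨?_, fun y hy => ?_⟩
  · refine contDiffOn_const.add (Real.contDiff_arctan.comp_contDiffOn
      (ContDiffOn.div ?_ ?_ fun y hy => ne_of_gt hy)) <;> fun_prop
  -- `X` and `Z` are the horizontal coordinates in the frame rotated by `a`; in that frame the angle
  -- is `arctan (Z / X)`, and the addition formulas rotate back.
  · set X := Real.cos a * y 0 + Real.sin a * y 1 with hX
    set Z := Real.cos a * y 1 - Real.sin a * y 0 with hZ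
    have hX0 : 0 < X := hy
    have h1 := Real.sin_sq_add_cos_sq a
    have hsum : y 0 ^ 2 + y 1 ^ 2 = X ^ 2 + Z ^ 2 := by
      rw [hX, hZ]; linear_combination (-(y 0 ^ 2 + y 1 ^ 2)) * h1
    have hρ : 0 < cylRadius y := by
      rw [cylRadius, hsum]; positivity
    have hs : √(1 + (Z / X) ^ 2) = cylRadius y / X := by
      rw [cylRadius, hsum, eq_div_iff hX0.ne', ← Real.sqrt_sq hX0.le, ← Real.sqrt_mul (by positivity),
        Real.sqrt_sq hX0.le]
      congr 1; field_simp
    have hc : Real.cos (Real.arctan (Z / X)) = X / cylRadius y := by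
      rw [Real.cos_arctan, hs, one_div_div]
    have hsn : Real.sin (Real.arctan (Z / X)) = Z / cylRadius y := by
      rw [Real.sin_arctan, hs, div_div_div_cancel_right₀ hX0.ne']
    refine ⟨hρ, ?_, ?_⟩
    · rw [polarBranch, Real.cos_add, hc, hsn]
      field_simp
      rw [hX, hZ]; linear_combination (-y 0) * h1
    · rw [polarBranch, Real.sin_add, hc, hsn]
      field_simp
      rw [hX, hZ]; linear_combination (-y 1) * h1

theorem polarHalfSpace_param {a r θ : ℝ} (hr : 0 < r) (hθ : |θ - a| < Real.pi / 2) (z : ℝ) :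
    ![r * Real.cos θ, r * Real.sin θ, z] ∈ polarHalfSpace a := by
  have : 0 < Real.cos (θ - a) := Real.cos_pos_of_mem_Ioo (abs_lt.1 hθ)
  simp only [polarHalfSpace, Set.mem_ofPred_eq, Matrix.cons_val_zero, Matrix.cons_val_one]
  rw [Real.cos_sub] at this
  nlinarith

theorem polarBranch_param {a r θ : ℝ} (hr : 0 < r) (hθ : |θ - a| < Real.pi / 2) (z : ℝ) :
    polarBranch a ![r * Real.cos θ, r * Real.sin θ, z] = θ := by
  have : (Real.cos a * (r * Real.sin θ) - Real.sin a * (r * Real.cos θ)) /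
      (Real.cos a * (r * Real.cos θ) + Real.sin a * (r * Real.sin θ)) = Real.tan (θ - a) := by
    rw [Real.tan_eq_sin_div_cos, Real.sin_sub, Real.cos_sub,
      ← mul_div_mul_left (Real.sin θ * _ - _) _ hr.ne']
    congr 1 <;> ring
  simp only [polarBranch, Matrix.cons_val_zero, Matrix.cons_val_one]
  rw [this, Real.arctan_tan (abs_lt.1 hθ).1 (abs_lt.1 hθ).2]
  ring

theorem cylRadius_param {r : ℝ} (hr : 0 < r) (θ z : ℝ) :
    cylRadius ![r * Real.cos θ, r * Real.sin θ, z] = r := by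
  simp only [cylRadius, Matrix.cons_val_zero, Matrix.cons_val_one]
  rw [show (r * Real.cos θ) ^ 2 + (r * Real.sin θ) ^ 2 = r ^ 2 by
    linear_combination r ^ 2 * Real.sin_sq_add_cos_sq θ, Real.sqrt_sq hr.le]

theorem exists_polar_angle (p : Vec3) :
    ∃ a, p 0 = cylRadius p * Real.cos a ∧ p 1 = cylRadius p * Real.sin a := by
  have h : ‖(⟨p 0, p 1⟩ : ℂ)‖ = cylRadius p := by
    rw [Complex.norm_def, Complex.normSq_mk, cylRadius]; ring_nf
  refine ⟨Complex.arg ⟨p 0, p 1⟩, ?_, ?_⟩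
  · rw [← h, Complex.norm_mul_cos_arg]
  · rw [← h, Complex.norm_mul_sin_arg]

theorem contDiffOn_cylRadius {V : Set Vec3} (h : ∀ x ∈ V, 0 < cylRadius x) :
    ContDiffOn ℝ ∞ cylRadius V := by
  refine ContDiffOn.sqrt (by fun_prop) fun x hx => ?_
  have := h x hx
  rw [cylRadius, Real.sqrt_pos] at this
  exact this.ne'

theorem IsPolarAngle.contDiffOn_helicalCoords {V : Set Vec3} {φ : Vec3 → ℝ} (h : IsPolarAngle V φ)
    (k : ℝ) : ContDiffOn ℝ ∞ (helicalCoords k φ) V :=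
  (contDiffOn_cylRadius fun x hx => (h.2 x hx).1).prodMk
    ((contDiff_apply ℝ ℝ (2 : Fin 3)).contDiffOn.sub (contDiffOn_const.mul h.1))

theorem IsPolarAngle.mono {V V' : Set Vec3} {φ : Vec3 → ℝ} (h : IsPolarAngle V φ) (hV : V' ⊆ V) :
    IsPolarAngle V' φ :=
  ⟨h.1.mono hV, fun x hx => h.2 x (hV hx)⟩

/-! ### Charts for the two generators -/

theorem exists_translational_chart {O : Set Vec3} (hO : IsOpen O) {p : Vec3} (hp : p ∈ O) :
    ∃ (V : Set Vec3) (W : Set (ℝ × ℝ)), p ∈ V ∧ V ⊆ O ∧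
      Nonempty (StraighteningChart (translationalField.η 0) V (fun y => (y 0, y 1)) W) := by
  let P : (ℝ × ℝ) × ℝ → Vec3 := fun q => ![q.1.1, q.1.2, q.2]
  have hP : ContDiff ℝ ∞ P := by
    refine contDiff_pi.2 fun i => ?_
    fin_cases i <;> simp [P] <;> fun_prop
  have hPy : ∀ y : Vec3, P ((y 0, y 1), y 2) = y := fun y => by
    funext i; fin_cases i <;> rfl
  obtain ⟨δ, hδ, hball⟩ := Metric.isOpen_iff.1 (hO.preimage hP.continuous) ((p 0, p 1), p 2)
    (by rw [Set.mem_preimage, hPy]; exact hp)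
  have hmem : ∀ w ∈ Metric.ball (p 0, p 1) δ, ∀ s ∈ Metric.ball (p 2) δ, P (w, s) ∈ O :=
    fun w hw s hs => hball (by rw [← ball_prod_same]; exact ⟨hw, hs⟩)
  refine ⟨{y | (y 0, y 1) ∈ Metric.ball (p 0, p 1) δ ∧ y 2 ∈ Metric.ball (p 2) δ},
    Metric.ball (p 0, p 1) δ, ⟨Metric.mem_ball_self hδ, Metric.mem_ball_self hδ⟩, fun y hy => ?_, ⟨?_⟩⟩
  · have := hmem _ hy.1 _ hy.2
    rwa [hPy] at this
  · exact
      { param := P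
        time := fun y => y 2
        t₀ := p 2
        δ := δ
        pos := hδ
        isOpen := (Metric.isOpen_ball.preimage (by fun_prop)).inter
          (Metric.isOpen_ball.preimage (by fun_prop))
        isOpen_inv := Metric.isOpen_ball
        contDiff_param := hP
        contDiffOn_inv := by fun_prop
        contDiffOn_time := by fun_prop
        inv_mem := fun y hy => hy.1
        time_mem := fun y hy => hy.2
        param_inv := fun y _ => hPy y
        param_mem := fun w hw s hs => ⟨hw, hs⟩
        inv_param := fun _ _ _ _ => rfl
        time_param := fun _ _ _ _ => rfl
        hasDerivAt_param := fun w s => by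
          refine hasDerivAt_pi.2 fun i => ?_
          fin_cases i
          · exact hasDerivAt_const s w.1
          · exact hasDerivAt_const s w.2
          · exact hasDerivAt_id s }

/-- The orbits are the helices `(r cos s, r sin s, u + k s)`: the polar angle is itself the flow
time, and `(r, u) = (ρ, z - k φ)` labels the orbit. -/
theorem exists_helical_chart (k : ℝ) {O : Set Vec3} (hO : IsOpen O) {p : Vec3} (hp : p ∈ O)
    (hρ : cylRadius p ≠ 0) :
    ∃ (V : Set Vec3) (φ : Vec3 → ℝ) (W : Set (ℝ × ℝ)), p ∈ V ∧ V ⊆ O ∧ IsPolarAngle V φ ∧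
      Nonempty (StraighteningChart ((helicalField k).η 0) V (helicalCoords k φ) W) := by
  have hρ0 : 0 < cylRadius p := lt_of_le_of_ne (Real.sqrt_nonneg _) hρ.symm
  obtain ⟨a, ha0, ha1⟩ := exists_polar_angle p
  let φ := polarBranch a
  let P : (ℝ × ℝ) × ℝ → Vec3 := fun q =>
    ![q.1.1 * Real.cos q.2, q.1.1 * Real.sin q.2, q.1.2 + k * q.2]
  have hP : ContDiff ℝ ∞ P := by
    refine contDiff_pi.2 fun i => ?_
    fin_cases i <;> simp [P] <;> fun_prop
  have hH := isPolarAngle_polarBranch a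
  have hPy : ∀ y ∈ polarHalfSpace a, P (helicalCoords k φ y, φ y) = y := fun y hy => by
    obtain ⟨-, h0, h1⟩ := hH.2 y hy
    funext i
    fin_cases i
    · exact h0.symm
    · exact h1.symm
    · simp [P, helicalCoords]
  have hpH : p ∈ polarHalfSpace a := by
    have : 0 < Real.cos a * p 0 + Real.sin a * p 1 := by
      rw [ha0, ha1, show Real.cos a * (cylRadius p * Real.cos a) +
        Real.sin a * (cylRadius p * Real.sin a) = cylRadius p by
        linear_combination cylRadius p * Real.sin_sq_add_cos_sq a]
      exact hρ0
    exact this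
  have hφp : φ p = a := by
    have := polarBranch_param (a := a) hρ0 (θ := a) (by simpa using Real.pi_div_two_pos) (p 2)
    rw [← ha0, ← ha1] at this
    rwa [show ![p 0, p 1, p 2] = p by funext i; fin_cases i <;> rfl] at this
  obtain ⟨ε, hε, hball⟩ := Metric.isOpen_iff.1 (hO.preimage hP.continuous) (helicalCoords k φ p, a)
    (by rw [Set.mem_preimage, ← hφp, hPy p hpH]; exact hp)
  -- The three bounds keep the box inside `O`, the radius positive, and the angle within the range
  -- of the chosen branch.
  set δ := min ε (min (cylRadius p) (Real.pi / 2)) with hδdef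
  have hδ : 0 < δ := lt_min hε (lt_min hρ0 Real.pi_div_two_pos)
  have hδε : δ ≤ ε := min_le_left _ _
  have hδρ : δ ≤ cylRadius p := (min_le_right _ _).trans (min_le_left _ _)
  have hδπ : δ ≤ Real.pi / 2 := (min_le_right _ _).trans (min_le_right _ _)
  have hmem : ∀ w ∈ Metric.ball (helicalCoords k φ p) δ, ∀ s ∈ Metric.ball a δ, P (w, s) ∈ O :=
    fun w hw s hs => hball (Metric.ball_subset_ball hδε (by rw [← ball_prod_same]; exact ⟨hw, hs⟩))
  have hr : ∀ w ∈ Metric.ball (helicalCoords k φ p) δ, 0 < w.1 := by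
    rintro ⟨r, u⟩ hw
    rw [helicalCoords, ← ball_prod_same] at hw
    have := abs_lt.1 (Real.dist_eq r (cylRadius p) ▸ Metric.mem_ball.1 hw.1)
    simp only at this ⊢
    linarith
  have hang : ∀ s ∈ Metric.ball a δ, |s - a| < Real.pi / 2 := fun s hs =>
    lt_of_lt_of_le (Real.dist_eq s a ▸ Metric.mem_ball.1 hs) hδπ
  have hPφ : ∀ w ∈ Metric.ball (helicalCoords k φ p) δ, ∀ s ∈ Metric.ball a δ, φ (P (w, s)) = s :=
    fun w hw s hs => polarBranch_param (hr w hw) (hang s hs) _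
  have hPinv : ∀ w ∈ Metric.ball (helicalCoords k φ p) δ, ∀ s ∈ Metric.ball a δ,
      helicalCoords k φ (P (w, s)) = w := fun w hw s hs => by
    rw [helicalCoords, hPφ w hw s hs, cylRadius_param (hr w hw)]
    simp [P]
  set V : Set Vec3 := polarHalfSpace a ∩
    (fun y => (helicalCoords k φ y, φ y)) ⁻¹' (Metric.ball (helicalCoords k φ p) δ ×ˢ Metric.ball a δ)
  have hVH : V ⊆ polarHalfSpace a := Set.inter_subset_left
  have hVφ : IsPolarAngle V φ := hH.mono hVH
  refine ⟨V, φ, Metric.ball (helicalCoords k φ p) δ,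
    ⟨hpH, Metric.mem_ball_self hδ, hφp.symm ▸ Metric.mem_ball_self hδ⟩, fun y hy => ?_,
    hVφ, ⟨?_⟩⟩
  · have := hmem _ hy.2.1 _ hy.2.2
    rwa [hPy y hy.1] at this
  · exact
      { param := P
        time := φ
        t₀ := a
        δ := δ
        pos := hδ
        isOpen := ((hH.contDiffOn_helicalCoords k).prodMk hH.1).continuousOn.isOpen_inter_preimage
          (isOpen_polarHalfSpace a) (Metric.isOpen_ball.prod Metric.isOpen_ball)
        isOpen_inv := Metric.isOpen_ball
        contDiff_param := hP
        contDiffOn_inv := hVφ.contDiffOn_helicalCoords k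
        contDiffOn_time := hVφ.1
        inv_mem := fun y hy => hy.2.1
        time_mem := fun y hy => hy.2.2
        param_inv := fun y hy => hPy y hy.1
        param_mem := fun w hw s hs => ⟨polarHalfSpace_param (hr w hw) (hang s hs) _, by
          rw [Set.mem_preimage, hPinv w hw s hs, hPφ w hw s hs]; exact ⟨hw, hs⟩⟩
        inv_param := hPinv
        time_param := hPφ
        hasDerivAt_param := fun w s => by
          refine hasDerivAt_pi.2 fun i => ?_
          fin_cases i
          · exact ((Real.hasDerivAt_cos s).const_mul w.1).congr_deriv (by simp [helicalField, P])
          · exact ((Real.hasDerivAt_sin s).const_mul w.1).congr_deriv (by simp [helicalField, P])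
          · exact (((hasDerivAt_id s).const_mul k).const_add w.2).congr_deriv
              (by simp [helicalField]) }

theorem contDiff_helicalField (k : ℝ) (t : ℝ) : ContDiff ℝ ∞ ((helicalField k).η t) := by
  refine contDiff_pi.2 fun i => ?_
  fin_cases i <;> simp [helicalField] <;> fun_prop

theorem fderiv_helicalField (k : ℝ) (t : ℝ) (y v : Vec3) :
    fderiv ℝ ((helicalField k).η t) y v = ![-v 1, v 0, 0] := by
  have dY := ((contDiff_helicalField k t).differentiable (by simp)) y
  funext i
  rw [← fderiv_component dY]
  fin_cases i
  · exact congrArg (fun f => f v) ((hasFDerivAt_apply (𝕜 := ℝ) (1 : Fin 3) y).fun_neg.fderiv)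
  · exact congrArg (fun f => f v) ((hasFDerivAt_apply (𝕜 := ℝ) (0 : Fin 3) y).fderiv)
  · exact congrArg (fun f => f v) ((hasFDerivAt_const (𝕜 := ℝ) k y).fderiv)

theorem contDiff_translationalField (t : ℝ) : ContDiff ℝ ∞ (translationalField.η t) :=
  contDiff_const

theorem fderiv_translationalField (t : ℝ) (y v : Vec3) :
    fderiv ℝ (translationalField.η t) y v = 0 :=
  congrArg (fun f => f v) ((hasFDerivAt_const (𝕜 := ℝ) (![0, 0, 1] : Vec3) y).fderiv)

/-- The `F₁`-part of the potential is radial, hence orthogonal to the generator, which is why `F₁`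
does not occur in the integral. -/
theorem helicalIntegral_eq_dotProduct {k : ℝ} {φ : Vec3 → ℝ} {F₁ F₂ F₃ : ℝ × ℝ → ℝ} {a y : Vec3}
    (h0 : a 0 = y 0 * F₁ (helicalCoords k φ y) - y 1 * F₂ (helicalCoords k φ y))
    (h1 : a 1 = y 1 * F₁ (helicalCoords k φ y) + y 0 * F₂ (helicalCoords k φ y))
    (h2 : a 2 = F₃ (helicalCoords k φ y)) (t : ℝ) (w : Vec3) :
    helicalIntegral k φ F₂ F₃ y w = (helicalField k).η t y ⬝ᵥ (w + a) := by
  simp only [helicalIntegral, helicalField, dotProduct, Fin.sum_univ_three, Matrix.cons_val_zero,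
    Matrix.cons_val_one, Matrix.cons_val, Pi.add_apply, h0, h1, h2]
  ring

theorem translationalIntegral_eq_dotProduct {F₃ : ℝ × ℝ → ℝ} {a y : Vec3}
    (h2 : a 2 = F₃ (y 0, y 1)) (t : ℝ) (w : Vec3) :
    translationalIntegral F₃ y w = translationalField.η t y ⬝ᵥ (w + a) := by
  simp [translationalIntegral, translationalField, dotProduct, Fin.sum_univ_three, h2]

/-! ### Invariant gauges and the normal forms -/

theorem grad3_neg (G : Vec3 → ℝ) (y : Vec3) : grad3 (fun z => -G z) y = -grad3 G y := by
  refine eq_of_forall_dotProduct fun w => ?_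
  rw [grad3_dotProduct, neg_dotProduct, grad3_dotProduct, fderiv_fun_neg]
  rfl

/-- In a straightening chart of a Killing field that preserves the potentials up to a gradient,
there is a gauge in which it preserves the potentials exactly. -/
theorem exists_invariant_gauge {T : EquivTransf} (hX : T.scaleX = 1) (hT : T.scaleT = 1)
    (hΦ₀ : T.shiftΦ = 0) {Ω : Set Vec3} (hΩ : IsOpen Ω) {A : Vec3 → Vec3} {Φ : Vec3 → ℝ}
    (hS : SmoothPotentials Ω A Φ) {η Y : Vec3 → Vec3} {σ : Vec3 → ℝ} {r : ℝ} (hr : r ≠ 0)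
    (hσ : ContDiffOn ℝ ∞ σ Ω) (hη : ∀ x, T.rot *ᵥ η x = r • Y (T.pos x)) (dη : Differentiable ℝ η)
    (hY : ContDiff ℝ ∞ Y)
    (hpres : ∀ x ∈ Ω, fderiv ℝ Φ x (η x) = 0 ∧ PreservesPotential A η σ x)
    {V : Set Vec3} {inv : Vec3 → ℝ × ℝ} {W : Set (ℝ × ℝ)} (c : StraighteningChart Y V inv W)
    (hV : V ⊆ T.pos '' Ω) :
    ∃ (g : Vec3 → ℝ) (A' : Vec3 → Vec3) (Φ' : Vec3 → ℝ),
      ContDiffOn ℝ ∞ A' V ∧ ContDiffOn ℝ ∞ Φ' V ∧ T.MapsPotentials g (T.pos ⁻¹' V) A Φ A' Φ' ∧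
      (∀ y ∈ V, fderiv ℝ Φ' y (Y y) = 0) ∧
      (∀ y ∈ V, ∀ v, v ⬝ᵥ fderiv ℝ A' y (Y y) + fderiv ℝ Y y v ⬝ᵥ A' y = 0) ∧
      ∀ x ∈ T.pos ⁻¹' V, ∀ v,
        η x ⬝ᵥ (v + A x) - σ x = r * (Y (T.pos x) ⬝ᵥ (T.vel v + A' (T.pos x))) := by
  have dY := hY.differentiable (by simp)
  have hinvL : ∀ y, HasFDerivAt T.invPos T.rotInvL y := fun y => by
    have := T.hasFDerivAt_invPos y
    rwa [hX, inv_one, one_smul] at this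
  have hmaps : ∀ y ∈ V, T.invPos y ∈ Ω := fun y hy => by
    have := hV hy
    rwa [T.image_pos] at this
  have hYinv : ∀ y, T.rotInvL (Y y) = r⁻¹ • η (T.invPos y) := fun y => by
    have := congrArg (fun v => r⁻¹ • T.rotᵀ *ᵥ v) (hη (T.invPos y))
    simp only [T.transpose_rot_mulVec, T.pos_invPos, Matrix.mulVec_smul, smul_smul,
      inv_mul_cancel₀ hr, one_smul] at this
    exact this.symm
  let A₁ : Vec3 → Vec3 := fun y => T.rotL (A (T.invPos y))
  let Φ₁ : Vec3 → ℝ := fun y => Φ (T.invPos y)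
  -- The factor `r⁻¹` appears because `Y` is `r⁻¹` times the image of `η`. The product is written in
  -- the shape `μ * ν * σ` delivered by `PreservesPotential.pullback`, with `μ = 1` and `ν = r⁻¹`.
  let σ₁ : Vec3 → ℝ := fun y => 1 * r⁻¹ * σ (T.invPos y)
  have sA₁ : ContDiffOn ℝ ∞ A₁ V :=
    T.rotL.contDiff.comp_contDiffOn (hS.1.comp T.contDiff_invPos.contDiffOn hmaps)
  have sΦ₁ : ContDiffOn ℝ ∞ Φ₁ V := hS.2.comp T.contDiff_invPos.contDiffOn hmaps
  have sσ₁ : ContDiffOn ℝ ∞ σ₁ V :=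
    contDiffOn_const.mul (hσ.comp T.contDiff_invPos.contDiffOn hmaps)
  have pA₁ : ∀ y ∈ V, PreservesPotential A₁ Y σ₁ y := fun y hy =>
    PreservesPotential.pullback (A₂ := A) (η₂ := η) (L := T.rotInvL) (L' := T.rotL) hinvL
      T.mulVec_dotProduct (Filter.Eventually.of_forall fun z => (one_smul ℝ _).symm)
      (Filter.Eventually.of_forall hYinv)
      (hS.1.differentiableAt_of_isOpen hΩ (hmaps y hy)) (dY y) (dη _)
      (hσ.differentiableAt_of_isOpen hΩ (hmaps y hy)) (hpres _ (hmaps y hy)).2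
  have pΦ₁ : ∀ y ∈ V, fderiv ℝ Φ₁ y (Y y) = 0 := fun y hy => by
    have h1 := (hS.2.differentiableAt_of_isOpen hΩ (hmaps y hy)).hasFDerivAt.comp y (hinvL y)
    have h2 : fderiv ℝ Φ₁ y = _ := h1.fderiv
    rw [h2, ContinuousLinearMap.comp_apply, hYinv, map_smul, (hpres _ (hmaps y hy)).1, smul_zero]
  -- `Y` preserves `∇G` up to the gradient of `Y G`. Choosing `Y G = σ₁` and subtracting `∇G` from
  -- `A₁` thus leaves no gradient term; in the sign convention of `MapsPotentials` the gauge
  -- function is `-G`.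
  obtain ⟨G, sG, hG⟩ := c.exists_primitive sσ₁
  have sgrad := grad3_contDiffOn c.isOpen sG
  refine ⟨fun y => -G y, fun y => A₁ y - grad3 G y, Φ₁, sA₁.sub sgrad, sΦ₁,
    ⟨by rw [T.image_pos_preimage]; exact sG.neg, fun x hx => ⟨?_, ?_⟩⟩, pΦ₁, fun y hy v => ?_,
    fun x hx v => ?_⟩
  · simp [A₁, hX, hT, grad3_neg, sub_eq_add_neg]
  · simp [Φ₁, hX, hT, hΦ₀]
  · have dG' := ((contDiffOn_infty_iff_fderiv_of_isOpen c.isOpen).1 sG).2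
    have h1 := (pA₁ y hy).sub (.grad c.isOpen sG hy (dY y))
      (sA₁.differentiableAt_of_isOpen c.isOpen hy) (sgrad.differentiableAt_of_isOpen c.isOpen hy)
      (sσ₁.differentiableAt_of_isOpen c.isOpen hy)
      ((dG'.clm_apply hY.contDiffOn).differentiableAt_of_isOpen c.isOpen hy)
    have h2 : (fun z => σ₁ z - fderiv ℝ G z (Y z)) =ᶠ[nhds y] fun _ => 0 := by
      filter_upwards [c.isOpen.mem_nhds hy] with z hz
      rw [hG z hz, sub_self]
    rw [h1 v, h2.fderiv_eq, fderiv_fun_const]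
    rfl
  · have h1 : η x = r • (T.rotᵀ *ᵥ Y (T.pos x)) := by
      rw [← Matrix.mulVec_smul, ← hη, T.transpose_rot_mulVec]
    have h2 := hG (T.pos x) hx
    simp only [T.invPos_pos, σ₁] at h2
    rw [h1, smul_dotProduct, T.transpose_mulVec_dotProduct, Matrix.mulVec_add]
    simp only [A₁, T.invPos_pos, T.rotL_apply, EquivTransf.vel, hX, hT, dotProduct_add,
      dotProduct_sub, dotProduct_grad3, h2]
    simp only [div_one, one_smul, smul_eq_mul]
    field_simp
    ring

theorem fderiv_component_of_preserves {A Y : Vec3 → Vec3} {y : Vec3} (dA : DifferentiableAt ℝ A y)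
    (h : ∀ v, v ⬝ᵥ fderiv ℝ A y (Y y) + fderiv ℝ Y y v ⬝ᵥ A y = 0) (i : Fin 3) :
    fderiv ℝ (fun z => A z i) y (Y y) = -(fderiv ℝ Y y (Pi.single i 1) ⬝ᵥ A y) := by
  have := h (Pi.single i 1)
  rw [single_one_dotProduct] at this
  rw [fderiv_component dA]
  linarith

/-- Invariance means that along the generator the pair `(A₀, A₁)` rotates exactly as `(x, y)` does,
so `x A₀ + y A₁` and `x A₁ - y A₀` are constant along it. Divided by `ρ²` they are `F₁` and `F₂`,
and solving the linear system recovers `A₀` and `A₁`. The component `A₂` and `Φ` are constant along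
the generator directly. -/
theorem exists_isHelicalCase {k : ℝ} {V : Set Vec3} {φ : Vec3 → ℝ} {W : Set (ℝ × ℝ)}
    (c : StraighteningChart ((helicalField k).η 0) V (helicalCoords k φ) W) (hφ : IsPolarAngle V φ)
    {A : Vec3 → Vec3} {Φ : Vec3 → ℝ} (sA : ContDiffOn ℝ ∞ A V) (sΦ : ContDiffOn ℝ ∞ Φ V)
    (hΦ : ∀ y ∈ V, fderiv ℝ Φ y ((helicalField k).η 0 y) = 0)
    (hA : ∀ y ∈ V, ∀ v, v ⬝ᵥ fderiv ℝ A y ((helicalField k).η 0 y)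
      + fderiv ℝ ((helicalField k).η 0) y v ⬝ᵥ A y = 0) :
    ∃ F₁ F₂ F₃ G : ℝ × ℝ → ℝ, IsHelicalCase k V φ F₁ F₂ F₃ G A Φ := by
  have hρ : ∀ y ∈ V, y 0 ^ 2 + y 1 ^ 2 ≠ 0 := fun y hy =>
    (Real.sqrt_pos.1 (hφ.2 y hy).1).ne'
  have dx : ∀ (y : Vec3) (i : Fin 3), HasFDerivAt (fun z : Vec3 => z i) _ y := fun y i =>
    hasFDerivAt_apply (𝕜 := ℝ) i y
  have dAi : ∀ y ∈ V, ∀ i, DifferentiableAt ℝ (fun z => A z i) y := fun y hy i =>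
    (contDiffOn_pi.1 sA i).differentiableAt_of_isOpen c.isOpen hy
  have hcomp : ∀ y ∈ V, fderiv ℝ (fun z => A z 0) y ((helicalField k).η 0 y) = -A y 1 ∧
      fderiv ℝ (fun z => A z 1) y ((helicalField k).η 0 y) = A y 0 ∧
      fderiv ℝ (fun z => A z 2) y ((helicalField k).η 0 y) = 0 := fun y hy => by
    have := fderiv_component_of_preserves (sA.differentiableAt_of_isOpen c.isOpen hy) (hA y hy)
    refine ⟨?_, ?_, ?_⟩ <;>
      simp [this, fderiv_helicalField, dotProduct, Fin.sum_univ_three]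
  have hquot : ∀ N : Vec3 → ℝ, ContDiffOn ℝ ∞ N V →
      (∀ y ∈ V, fderiv ℝ N y ((helicalField k).η 0 y) = 0) →
      ∃ F : ℝ × ℝ → ℝ, ContDiffOn ℝ ∞ F W ∧
        ∀ y ∈ V, N y / (y 0 ^ 2 + y 1 ^ 2) = F (helicalCoords k φ y) := fun N sN hN => by
    have sD : ContDiff ℝ ∞ fun y : Vec3 => y 0 ^ 2 + y 1 ^ 2 := by fun_prop
    refine c.exists_factor (sN.div sD.contDiffOn hρ) fun y hy => ?_
    have dQ : HasFDerivAt (fun z => N z / (z 0 ^ 2 + z 1 ^ 2)) _ y := ((sN.div sD.contDiffOn hρ).differentiableAt_of_isOpen c.isOpen hy).hasFDerivAt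
    -- With `Q = N / ρ²`, the identity `Q ρ² = N` is differentiated along the generator. Both `N`
    -- and `ρ²` are constant along it, which leaves `ρ²` times the derivative of `Q` equal to zero.
    have h1 := dQ.fun_mul (((dx y 0).fun_mul (dx y 0)).fun_add ((dx y 1).fun_mul (dx y 1)))
    have h2 : (fun z => N z / (z 0 ^ 2 + z 1 ^ 2) * (z 0 * z 0 + z 1 * z 1)) =ᶠ[nhds y] N := by
      filter_upwards [c.isOpen.mem_nhds hy] with z hz
      rw [← sq, ← sq, div_mul_cancel₀ _ (hρ z hz)]
    have h3 := congrArg (fun f => f ((helicalField k).η 0 y)) (h2.fderiv_eq.symm.trans h1.fderiv)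
    simp only [hN y hy] at h3
    have h4 : ((helicalField k).η 0 y) 0 = - y 1 ∧ ((helicalField k).η 0 y) 1 = y 0 := ⟨rfl, rfl⟩
    simp [h4] at h3
    rw [dQ.fderiv]
    refine (mul_eq_zero.1 ?_).resolve_left (hρ y hy)
    linear_combination -h3
  obtain ⟨F₁, sF₁, hF₁⟩ := hquot (fun y => y 0 * A y 0 + y 1 * A y 1)
    (by have := contDiffOn_pi.1 sA; exact (by fun_prop : ContDiffOn ℝ ∞ (fun y : Vec3 => y 0) V).mul
          (this 0) |>.add ((by fun_prop : ContDiffOn ℝ ∞ (fun y : Vec3 => y 1) V).mul (this 1)))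
    fun y hy => by
      have h0 := ((dx y 0).fun_mul (dAi y hy 0).hasFDerivAt).fun_add
        ((dx y 1).fun_mul (dAi y hy 1).hasFDerivAt)
      obtain ⟨e0, e1, -⟩ := hcomp y hy
      rw [h0.fderiv]
      simp [e0, e1]
      simp [helicalField]
      ring
  obtain ⟨F₂, sF₂, hF₂⟩ := hquot (fun y => y 0 * A y 1 - y 1 * A y 0)
    (by have := contDiffOn_pi.1 sA; exact (by fun_prop : ContDiffOn ℝ ∞ (fun y : Vec3 => y 0) V).mul
          (this 1) |>.sub ((by fun_prop : ContDiffOn ℝ ∞ (fun y : Vec3 => y 1) V).mul (this 0)))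
    fun y hy => by
      have h0 := ((dx y 0).fun_mul (dAi y hy 1).hasFDerivAt).fun_sub
        ((dx y 1).fun_mul (dAi y hy 0).hasFDerivAt)
      obtain ⟨e0, e1, -⟩ := hcomp y hy
      rw [h0.fderiv]
      simp [e0, e1]
      simp [helicalField]
      ring
  obtain ⟨F₃, sF₃, hF₃⟩ := c.exists_factor (contDiffOn_pi.1 sA 2) fun y hy => (hcomp y hy).2.2
  obtain ⟨G, sG, hG⟩ := c.exists_factor sΦ hΦ
  refine ⟨F₁, F₂, F₃, G, hφ, ⟨W, c.isOpen_inv, c.inv_mem, sF₁, sF₂, sF₃, sG⟩, fun y hy =>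
    ⟨?_, ?_, hF₃ y hy, hG y hy⟩⟩ <;>
  · rw [← hF₁ y hy, ← hF₂ y hy]
    have := hρ y hy
    field_simp
    ring

/-- The generator has zero Jacobian, so invariance of the vector potential is invariance of each
Cartesian component. -/
theorem exists_isTranslationalCase {V : Set Vec3} {W : Set (ℝ × ℝ)}
    (c : StraighteningChart (translationalField.η 0) V (fun y => (y 0, y 1)) W)
    {A : Vec3 → Vec3} {Φ : Vec3 → ℝ} (sA : ContDiffOn ℝ ∞ A V) (sΦ : ContDiffOn ℝ ∞ Φ V)
    (hΦ : ∀ y ∈ V, fderiv ℝ Φ y (translationalField.η 0 y) = 0)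
    (hA : ∀ y ∈ V, ∀ v, v ⬝ᵥ fderiv ℝ A y (translationalField.η 0 y)
      + fderiv ℝ (translationalField.η 0) y v ⬝ᵥ A y = 0) :
    ∃ F₁ F₂ F₃ G : ℝ × ℝ → ℝ, IsTranslationalCase V F₁ F₂ F₃ G A Φ := by
  have hcomp : ∀ i, ∀ y ∈ V, fderiv ℝ (fun z => A z i) y (translationalField.η 0 y) = 0 :=
    fun i y hy => by
      rw [fderiv_component_of_preserves (sA.differentiableAt_of_isOpen c.isOpen hy) (hA y hy),
        fderiv_translationalField, zero_dotProduct, neg_zero]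
  obtain ⟨F₁, sF₁, hF₁⟩ := c.exists_factor (contDiffOn_pi.1 sA 0) (hcomp 0)
  obtain ⟨F₂, sF₂, hF₂⟩ := c.exists_factor (contDiffOn_pi.1 sA 1) (hcomp 1)
  obtain ⟨F₃, sF₃, hF₃⟩ := c.exists_factor (contDiffOn_pi.1 sA 2) (hcomp 2)
  obtain ⟨G, sG, hG⟩ := c.exists_factor sΦ hΦ
  exact ⟨F₁, F₂, F₃, G, ⟨W, c.isOpen_inv, c.inv_mem, sF₁, sF₂, sF₃, sG⟩, fun y hy =>
    ⟨hF₁ y hy, hF₂ y hy, hF₃ y hy, hG y hy⟩⟩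

/-- Every involutive Noether integral is, up to equivalence, helical or translational. -/
theorem reduces_of_admits {Ω : Set Vec3} {A : Vec3 → Vec3} {Φ : Vec3 → ℝ} {X : PointField}
    {I : ℝ → Vec3 → Vec3 → ℝ} (hΩ : IsOpen Ω) (hc : IsConnected Ω) (hS : SmoothPotentials Ω A Φ)
    (h : AdmitsInvolutiveIntegral Ω A Φ X I) :
    ∃ (T : EquivTransf) (a b : ℝ), a ≠ 0 ∧
      ((∃ k : ℝ, T.MapsField Ω X (helicalField k) ∧
          ∀ p ∈ Ω, cylRadius (T.pos p) ≠ 0 →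
            ∃ (U : Set Vec3) (J : Vec3 → Vec3 → ℝ), IsOpen U ∧ p ∈ U ∧ U ⊆ Ω ∧
              ReducesToHelical T k U A Φ J ∧
              ∀ (t : ℝ), ∀ x ∈ U, ∀ v : Vec3,
                I t x v = a * J x v + b * hamiltonian Φ x v) ∨
        (T.MapsField Ω X translationalField ∧
          ∀ p ∈ Ω,
            ∃ (U : Set Vec3) (J : Vec3 → Vec3 → ℝ), IsOpen U ∧ p ∈ U ∧ U ⊆ Ω ∧
              ReducesToTranslational T U A Φ J ∧
              ∀ (t : ℝ), ∀ x ∈ U, ∀ v : Vec3,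
                I t x v = a * J x v + b * hamiltonian Φ x v)) := by
  obtain ⟨ξ₀, c, w, σ, hcw, sσ, hall⟩ := exists_killing_of_admits hΩ hc hS h
  have dη : Differentiable ℝ fun y => c + crossProduct w y :=
    (differentiable_const c).add
      ((LinearMap.toContinuousLinearMap (crossProduct w)).differentiable)
  have hpres := fun x hx => And.intro (hall x hx).1 (hall x hx).2.1
  have hsub : ∀ (T : EquivTransf) (V : Set Vec3), V ⊆ T.pos '' Ω → T.pos ⁻¹' V ⊆ Ω :=
    fun T V hV x hx => by
      obtain ⟨y, hy, hyx⟩ := hV hx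
      rwa [← T.invPos_pos x, ← hyx, T.invPos_pos]
  by_cases hw : w = 0
  · have hc0 : c ≠ 0 := hcw.resolve_left (not_not.2 hw)
    obtain ⟨R, hR, r, hr, hRc, -⟩ := exists_rotation hc0
    let T : EquivTransf := ⟨R, hR, 1, one_ne_zero, 1, one_ne_zero, 0, 0, 0⟩
    have hη : ∀ x, T.rot *ᵥ (c + crossProduct w x) = r • translationalField.η 0 (T.pos x) := by
      intro x
      rw [hw, map_zero, LinearMap.zero_apply, add_zero]
      exact hRc.trans (by ext i; fin_cases i <;> simp [translationalField])
    -- The integral is `η · (v + A) - σ - ξ₀ H`, and the invariant gauge turns the first two terms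
    -- into `r` times the model integral; hence `a = r` and `b = -ξ₀`. The time is not rescaled, so
    -- the `∂_t` part is `ξ₀`.
    refine ⟨T, r, -ξ₀, hr, Or.inr ⟨⟨r, ξ₀, hr, fun t x hx => ⟨?_, ?_⟩⟩, fun p hp => ?_⟩⟩
    · rw [((hall x hx).2.2 t).1]
      simp [T, translationalField]
    · rw [((hall x hx).2.2 t).2.1, hη, show T.scaleX = 1 from rfl, one_smul]
      rfl
    · obtain ⟨V, W, hpV, hV, ⟨ch⟩⟩ :=
        exists_translational_chart (T.isOpen_image_pos hΩ) (Set.mem_image_of_mem T.pos hp)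
      obtain ⟨g, A', Φ', sA', sΦ', hmap, hΦ', hA', hI⟩ := exists_invariant_gauge (T := T) rfl rfl rfl
        hΩ hS hr sσ hη dη (contDiff_translationalField 0) hpres ch hV
      obtain ⟨F₁, F₂, F₃, G, hcase⟩ := exists_isTranslationalCase ch sA' sΦ' hΦ' hA'
      refine ⟨T.pos ⁻¹' V, fun x v => translationalIntegral F₃ (T.pos x) (T.vel v),
        ch.isOpen.preimage T.contDiff_pos.continuous, hpV, hsub T V hV,
        ⟨g, F₁, F₂, F₃, G, A', Φ', hmap, by rwa [T.image_pos_preimage], fun _ _ _ => rfl⟩,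
        fun t x hx v => ?_⟩
      beta_reduce
      rw [((hall x (hsub T V hV hx)).2.2 t).2.2 v,
        translationalIntegral_eq_dotProduct (hcase.2 _ hx).2.2.1 0, ← hI x hx v]
      ring
  · obtain ⟨R, hR, r, hr, -, hRw⟩ := exists_rotation hw
    -- The shift absorbs the horizontal part of `R c` into the rotation term, that is, it moves the
    -- screw axis onto the `z`-axis. The remaining vertical part of `R c`, divided by `r`, is the
    -- pitch `k`.
    let T : EquivTransf := ⟨R, hR, 1, one_ne_zero, 1, one_ne_zero, 0,
      ![(R *ᵥ c) 1 / r, -(R *ᵥ c) 0 / r, 0], 0⟩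
    obtain ⟨k, hk⟩ : ∃ k, k = (R *ᵥ c) 2 / r := ⟨_, rfl⟩
    have hη : ∀ x, T.rot *ᵥ (c + crossProduct w x) = r • (helicalField k).η 0 (T.pos x) := by
      intro x
      change R *ᵥ (c + crossProduct w x) = _
      rw [Matrix.mulVec_add, hRw]
      have hTx : T.pos x = R *ᵥ x + ![(R *ᵥ c) 1 / r, -(R *ᵥ c) 0 / r, 0] := by
        simp [EquivTransf.pos, T]
      rw [hTx]
      clear hTx
      generalize R *ᵥ x = x' at *
      generalize R *ᵥ c = c' at *
      funext i
      fin_cases i <;> simp [helicalField, hk, Matrix.vecHead, Matrix.vecTail] <;> field_simp <;> ring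
    refine ⟨T, r, -ξ₀, hr, Or.inl ⟨k, ⟨r, ξ₀, hr, fun t x hx => ⟨?_, ?_⟩⟩, fun p hp hρ => ?_⟩⟩
    · rw [((hall x hx).2.2 t).1]
      simp [T, helicalField]
    · rw [((hall x hx).2.2 t).2.1, hη, show T.scaleX = 1 from rfl, one_smul]
      rfl
    · obtain ⟨V, φ, W, hpV, hV, hφ, ⟨ch⟩⟩ :=
        exists_helical_chart k (T.isOpen_image_pos hΩ) (Set.mem_image_of_mem T.pos hp) hρ
      obtain ⟨g, A', Φ', sA', sΦ', hmap, hΦ', hA', hI⟩ := exists_invariant_gauge (T := T) rfl rfl rfl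
        hΩ hS hr sσ hη dη (contDiff_helicalField k 0) hpres ch hV
      obtain ⟨F₁, F₂, F₃, G, hcase⟩ := exists_isHelicalCase ch hφ sA' sΦ' hΦ' hA'
      refine ⟨T.pos ⁻¹' V, fun x v => helicalIntegral k φ F₂ F₃ (T.pos x) (T.vel v),
        ch.isOpen.preimage T.contDiff_pos.continuous, hpV, hsub T V hV,
        ⟨g, φ, F₁, F₂, F₃, G, A', Φ', hmap, by rwa [T.image_pos_preimage], fun _ _ _ => rfl⟩,
        fun t x hx v => ?_⟩
      have hcx := hcase.2.2 _ hx
      beta_reduce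
      rw [((hall x (hsub T V hV hx)).2.2 t).2.2 v,
        helicalIntegral_eq_dotProduct hcx.1 hcx.2.1 hcx.2.2.1 0, ← hI x hx v]
      ring

/-! ### Involutive integrals from invariant potentials -/

/-- The exceptional vectors lie on the line spanned by `u`, a proper subspace, which has empty
interior. It is applied with `u` the value of the Killing field, since the velocity gradients of the
integral and of `H` are `η` and `v`. -/
theorem dense_linearIndependent_pair {u : Vec3} (hu : u ≠ 0) :
    Dense {v : Vec3 | LinearIndependent ℝ ![u, v]} := by
  have hne : Submodule.span ℝ {u} ≠ ⊤ := fun h => by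
    have h1 := finrank_span_singleton (K := ℝ) hu
    rw [h, finrank_top, Module.finrank_fin_fun] at h1
    omega
  have hint : interior (Submodule.span ℝ {u} : Set Vec3) = ∅ := by
    by_contra h
    exact hne (Submodule.eq_top_of_nonempty_interior' _ (Set.nonempty_iff_ne_empty.2 h))
  refine (interior_eq_empty_iff_dense_compl.1 hint).mono fun v hv => ?_
  refine (LinearIndependent.pair_iff' hu).2 fun a ha => hv ?_
  rw [← ha]
  exact Submodule.smul_mem _ _ (Submodule.mem_span_singleton_self u)

theorem hasDerivAt_dotProduct {a b : ℝ → Vec3} {a' b' : Vec3} {t : ℝ}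
    (ha : HasDerivAt a a' t) (hb : HasDerivAt b b' t) :
    HasDerivAt (fun s => a s ⬝ᵥ b s) (a t ⬝ᵥ b' + a' ⬝ᵥ b t) t := by
  have := (hasFDerivAt_dotProduct ha.hasFDerivAt hb.hasFDerivAt).hasDerivAt
  simpa [dotProduct_comm] using this

/-- A nowhere vanishing Killing field that preserves the potentials yields an involutive
integral. -/
theorem admits_of_preserves {U : Set Vec3} (hU : IsOpen U) {A : Vec3 → Vec3} {Φ : Vec3 → ℝ}
    (hS : SmoothPotentials U A Φ) {η : Vec3 → Vec3} {σ : Vec3 → ℝ} (sη : ContDiffOn ℝ ∞ η U)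
    (sσ : ContDiffOn ℝ ∞ σ U) (hskew : ∀ x ∈ U, ∀ v, fderiv ℝ η x v ⬝ᵥ v = 0)
    (hne : ∀ x ∈ U, η x ≠ 0) (hΦ : ∀ x ∈ U, fderiv ℝ Φ x (η x) = 0)
    (hA : ∀ x ∈ U, PreservesPotential A η σ x) {J : Vec3 → Vec3 → ℝ}
    (hJ : ∀ x ∈ U, ∀ v, J x v = η x ⬝ᵥ (v + A x) - σ x) :
    AdmitsInvolutiveIntegral U A Φ ⟨fun _ _ => 0, fun _ => η⟩ (fun _ => J) := by
  have hI : ∀ (t : ℝ), ∀ x ∈ U, ∀ v, J x v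
      = noetherIntegral A Φ ⟨fun _ _ => 0, fun _ => η⟩ (fun _ => σ) t x v := fun t x hx v => by
    rw [hJ x hx v]; simp [noetherIntegral]
  have dA := fun x (hx : x ∈ U) => hS.1.differentiableAt_of_isOpen hU hx
  have dΦ := fun x (hx : x ∈ U) => hS.2.differentiableAt_of_isOpen hU hx
  have dη := fun x (hx : x ∈ U) => sη.differentiableAt_of_isOpen hU hx
  have dσ := fun x (hx : x ∈ U) => sσ.differentiableAt_of_isOpen hU hx
  refine ⟨⟨fun _ => σ, ⟨⟨contDiffOn_const, ?_⟩, ?_, fun t x hx v => ?_⟩, hI⟩, ?_, fun t => ?_,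
    fun t x hx v => ?_⟩
  · exact sη.comp contDiff_snd.contDiffOn fun p hp => hp.2
  · exact sσ.comp contDiff_snd.contDiffOn fun p hp => hp.2
  · rw [noether_lhs_eq (X := ⟨fun _ _ => 0, fun _ => η⟩) (dA x hx) (dΦ x hx)
      (differentiableAt_const _) (dη x hx), totalDeriv, dotProduct_grad3]
    have h1 := hA x hx v
    have h2 := hskew x hx v
    simp only [deriv_const, fderiv_fun_const, Pi.zero_apply, _root_.zero_apply, zero_add, add_zero,
      mul_zero, dotProduct_add, hΦ x hx]
    linarith
  · intro S γ w hS hconn hsol s hs t ht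
    have key : ∀ r ∈ S, HasDerivAt (fun r => η (γ r) ⬝ᵥ (w r + A (γ r)) - σ (γ r)) 0 r := by
      intro r hr
      obtain ⟨hγU, hγ, hw⟩ := hsol r hr
      have h1 := (dη _ hγU).hasFDerivAt.comp_hasDerivAt r hγ
      have h2 := (dA _ hγU).hasFDerivAt.comp_hasDerivAt r hγ
      have h3 := (dσ _ hγU).hasFDerivAt.comp_hasDerivAt r hγ
      have h4 := (hasDerivAt_dotProduct h1 (hw.add h2)).sub h3
      refine h4.congr_deriv ?_
      -- The magnetic force contributes `η · (w × B) = B · (η × w) = w · DA η - η · DA w`. The last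
      -- term cancels against the derivative of `A` along the path; the first, together with `Dη w ·
      -- A`, cancels the derivative of `σ`.
      have e1 := curl3_dotProduct_crossProduct (dA _ hγU) (η (γ r)) (w r)
      have e2 := hA _ hγU (w r)
      have e3 := hskew _ hγU (w r)
      simp only [Function.comp_apply, Pi.add_apply, dotProduct_add, dotProduct_sub, dotProduct_grad3,
        hΦ _ hγU]
      rw [triple_product_permutation, triple_product_permutation]
      linarith
    have := hS.is_const_of_deriv_eq_zero hconn.isPreconnected
      (fun r hr => (key r hr).differentiableAt.differentiableWithinAt)
      (fun r hr => (key r hr).deriv) hs ht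
    simp only [hJ _ (hsol s hs).1, hJ _ (hsol t ht).1]
    exact this
  -- It suffices to move the velocity at fixed position: independence of the velocity parts `η x`
  -- and `w` of the differentials already implies independence of the differentials.
  · rintro ⟨x, v⟩ ⟨hx, -⟩
    refine map_mem_closure (f := fun v => (x, v)) (by fun_prop)
      (dense_linearIndependent_pair (hne x hx) v) fun w hw => ⟨hx, ?_⟩
    refine LinearIndependent.of_comp (LinearMap.snd ℝ Vec3 Vec3) ?_
    have e1 : grad3 (J x) w = η x := by
      rw [show J x = noetherIntegral A Φ ⟨fun _ _ => 0, fun _ => η⟩ (fun _ => σ) t x from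
        funext (hI t x hx), grad3_noetherIntegral_velocity]
      simp
    have : LinearMap.snd ℝ Vec3 Vec3 ∘ ![(grad3 (fun y => J y w) x, grad3 (J x) w),
        (grad3 (fun y => hamiltonian Φ y w) x, grad3 (hamiltonian Φ x) w)] = ![η x, w] := by
      funext i
      fin_cases i
      · exact e1
      · exact grad3_hamiltonian_velocity Φ x w
    rw [this]
    exact hw
  · rw [poissonBracket_congr hU A (hI t) hx, poissonBracket_noetherIntegral (dA x hx) (dΦ x hx)
      (dη x hx) (differentiableAt_const _) (dσ x hx)]
    have h1 := hA x hx v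
    have h2 := hskew x hx v
    simp only [fderiv_fun_const, Pi.zero_apply, _root_.zero_apply, zero_mul, sub_zero,
      dotProduct_add, hΦ x hx]
    linarith

/-- Involutive integrals from potentials that an equivalence transformation maps to potentials
invariant under the Killing field `Y`. -/
theorem admits_of_mapsPotentials {T : EquivTransf} {U : Set Vec3} (hU : IsOpen U)
    {A A' : Vec3 → Vec3} {Φ Φ' g : Vec3 → ℝ} (hS : SmoothPotentials U A Φ)
    (hmap : T.MapsPotentials g U A Φ A' Φ') {Y : Vec3 → Vec3} (sY : ContDiff ℝ ∞ Y)
    (hskew : ∀ y v, fderiv ℝ Y y v ⬝ᵥ v = 0) (hne : ∀ y ∈ T.pos '' U, Y y ≠ 0)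
    (sA' : ContDiffOn ℝ ∞ A' (T.pos '' U)) (sΦ' : ContDiffOn ℝ ∞ Φ' (T.pos '' U))
    (hΦ' : ∀ y ∈ T.pos '' U, fderiv ℝ Φ' y (Y y) = 0)
    (hA' : ∀ y ∈ T.pos '' U, ∀ v, v ⬝ᵥ fderiv ℝ A' y (Y y) + fderiv ℝ Y y v ⬝ᵥ A' y = 0)
    {J : Vec3 → Vec3 → ℝ}
    (hJ : ∀ x ∈ U, ∀ v, J x v = Y (T.pos x) ⬝ᵥ (T.vel v + A' (T.pos x))) :
    AdmitsInvolutiveIntegral U A Φ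
      ⟨fun _ _ => 0, fun _ x => (T.scaleX / T.scaleT) • (T.rotᵀ *ᵥ Y (T.pos x))⟩ (fun _ => J) := by
  have hV := T.isOpen_image_pos hU
  set V := T.pos '' U with hVdef
  have hmem : ∀ x ∈ U, T.pos x ∈ V := fun x hx => Set.mem_image_of_mem _ hx
  obtain ⟨l, hl⟩ : ∃ l, l = T.scaleX / T.scaleT := ⟨_, rfl⟩
  have hl0 : l ≠ 0 := hl ▸ div_ne_zero T.scaleX_ne T.scaleT_ne
  have hX0 := T.scaleX_ne
  have dY := sY.differentiable (by simp)
  obtain ⟨sg, hmap⟩ := hmap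
  have sgrad := grad3_contDiffOn hV sg
  rw [← hl]
  -- The factor `l` is chosen so that `η x · v = Y (T.pos x) · T.vel v`; then `J` is the Noether
  -- integral of `η` without a further constant.
  let η : Vec3 → Vec3 := fun x => l • T.rotInvL (Y (T.pos x))
  have sη : ContDiff ℝ ∞ η := (T.rotInvL.contDiff.comp (sY.comp T.contDiff_pos)).const_smul l
  have hη : ∀ x v, fderiv ℝ η x v = (l * T.scaleX) • T.rotInvL (fderiv ℝ Y (T.pos x) (T.rotL v)) := by
    intro x v
    have : HasFDerivAt η _ x := (T.rotInvL.hasFDerivAt.comp x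
      ((dY (T.pos x)).hasFDerivAt.comp x (T.hasFDerivAt_pos x))).const_smul l
    rw [this.fderiv]
    simp [smul_smul]
  have hRη : ∀ x, (T.scaleX • T.rotL) (η x) = (l * T.scaleX) • Y (T.pos x) := by
    intro x
    simp only [η, _root_.smul_apply, map_smul, T.rotL_apply, T.rotInvL_apply,
      T.rot_transpose_mulVec, smul_smul]
  -- The rescaled rotation of `A` is `A' - ∇g`. Since `Y` preserves `A'` exactly, it preserves this
  -- difference up to the gradient of `-Y g`; the `0` is the function belonging to `A'`.
  let σ₂ : Vec3 → ℝ := fun y => 0 - fderiv ℝ g y (Y y)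
  have sσ₂ : ContDiffOn ℝ ∞ σ₂ V := contDiffOn_const.sub
    (((contDiffOn_infty_iff_fderiv_of_isOpen hV).1 sg).2.clm_apply sY.contDiffOn)
  have hP₂ : ∀ y ∈ V, PreservesPotential (fun z => A' z - grad3 g z) Y σ₂ y := fun y hy =>
    PreservesPotential.sub (σ₁ := fun _ => 0) (fun v => by rw [hA' y hy v, fderiv_fun_const]; rfl)
      (.grad hV sg hy (dY y)) (sA'.differentiableAt_of_isOpen hV hy)
      (sgrad.differentiableAt_of_isOpen hV hy) (differentiableAt_const _)
      ((((contDiffOn_infty_iff_fderiv_of_isOpen hV).1 sg).2.clm_apply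
        sY.contDiffOn).differentiableAt_of_isOpen hV hy)
  -- These are the factors `μ` and `ν` of `PreservesPotential.pullback` for the linear part
  -- `T.scaleX • T.rotL` and its adjoint.
  have hμν : l⁻¹ * T.scaleX⁻¹ * (l * T.scaleX) = 1 := by field_simp
  have hAeq : ∀ x ∈ U, A x = (l⁻¹ * T.scaleX⁻¹) •
      (T.scaleX • T.rotInvL) (A' (T.pos x) - grad3 g (T.pos x)) := by
    intro x hx
    rw [(hmap x hx).1, ← hl, add_sub_cancel_right]
    simp only [_root_.smul_apply, map_smul, T.rotInvL_apply, T.transpose_rot_mulVec, smul_smul,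
      hμν, one_smul]
  refine admits_of_preserves hU hS (η := η)
    (σ := fun x => l⁻¹ * T.scaleX⁻¹ * (l * T.scaleX) * σ₂ (T.pos x)) sη.contDiffOn
    (contDiffOn_const.mul (sσ₂.comp T.contDiff_pos.contDiffOn hmem)) (fun x hx v => ?_)
    (fun x hx h => ?_) (fun x hx => ?_) (fun x hx => ?_) fun x hx v => ?_
  · rw [hη, smul_dotProduct, T.rotInvL_apply, T.transpose_mulVec_dotProduct, T.rotL_apply, hskew,
      smul_zero]
  · have := hRη x
    rw [h, map_zero] at this
    exact (smul_ne_zero (mul_ne_zero hl0 hX0) (hne _ (hmem x hx))) this.symm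
  · have h1 := (sΦ'.differentiableAt_of_isOpen hV (hmem x hx)).hasFDerivAt.comp x
      (T.hasFDerivAt_pos x)
    have h2 := ((hS.2.differentiableAt_of_isOpen hU hx).hasFDerivAt.const_mul
      (T.scaleX ^ 2 / T.scaleT ^ 2)).add_const T.shiftΦ
    have h3 : Φ' ∘ T.pos =ᶠ[nhds x] fun x => T.scaleX ^ 2 / T.scaleT ^ 2 * Φ x + T.shiftΦ := by
      filter_upwards [hU.mem_nhds hx] with z hz using (hmap z hz).2
    have h4 := congrArg (fun f => f (η x)) ((h1.congr_of_eventuallyEq h3.symm).unique h2)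
    simp only [ContinuousLinearMap.comp_apply, hRη, map_smul, hΦ' _ (hmem x hx),
      _root_.smul_apply, smul_eq_mul] at h4
    refine (mul_eq_zero.1 (h4.symm.trans (mul_zero _))).resolve_left ?_
    exact div_ne_zero (pow_ne_zero 2 hX0) (pow_ne_zero 2 T.scaleT_ne)
  · refine PreservesPotential.pullback (A₂ := fun z => A' z - grad3 g z) (η₂ := Y)
      (L := T.scaleX • T.rotL) (L' := T.scaleX • T.rotInvL) T.hasFDerivAt_pos (fun a v => ?_) ?_
      (Filter.Eventually.of_forall hRη)
      ((sA'.sub sgrad).differentiableAt_of_isOpen hV (hmem x hx))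
      (sη.differentiable (by simp) x) (dY _) (sσ₂.differentiableAt_of_isOpen hV (hmem x hx))
      (hP₂ _ (hmem x hx))
    · simp [T.transpose_mulVec_dotProduct]
    · filter_upwards [hU.mem_nhds hx] with z hz using hAeq z hz
  · rw [hJ x hx v, hμν, (hmap x hx).1, ← hl]
    simp only [η, σ₂, smul_dotProduct, T.rotInvL_apply, T.transpose_mulVec_dotProduct,
      EquivTransf.vel, ← hl, dotProduct_add, dotProduct_smul, dotProduct_grad3]
    simp only [smul_eq_mul]
    ring

theorem mapsField_of_pullback (T : EquivTransf) (U : Set Vec3) {Y : PointField}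
    (hξ : ∀ t x, Y.ξ t x = 0) (hη : ∀ t x, Y.η t x = Y.η 0 x) :
    T.MapsField U
      ⟨fun _ _ => 0, fun _ x => (T.scaleX / T.scaleT) • (T.rotᵀ *ᵥ Y.η 0 (T.pos x))⟩ Y := by
  refine ⟨T.scaleX * (T.scaleX / T.scaleT), 0,
    mul_ne_zero T.scaleX_ne (div_ne_zero T.scaleX_ne T.scaleT_ne), fun t x _ => ⟨?_, ?_⟩⟩
  · simp [hξ]
  · rw [hη, Matrix.mulVec_smul, T.rot_transpose_mulVec, smul_smul]

theorem helicalField_skew (k t : ℝ) (y v : Vec3) :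
    fderiv ℝ ((helicalField k).η t) y v ⬝ᵥ v = 0 := by
  rw [fderiv_helicalField]
  simp [dotProduct, Fin.sum_univ_three]
  ring

/-- Along the helical generator the invariants `(ρ, z - kφ)` are constant. -/
theorem fderiv_helicalCoords {k : ℝ} {V : Set Vec3} (hV : IsOpen V) {φ : Vec3 → ℝ}
    (hφ : IsPolarAngle V φ) {y : Vec3} (hy : y ∈ V) :
    fderiv ℝ (helicalCoords k φ) y ((helicalField k).η 0 y) = 0 := by
  have sρ := contDiffOn_cylRadius fun x hx => (hφ.2 x hx).1
  have dρ := (sρ.differentiableAt_of_isOpen hV hy).hasFDerivAt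
  have dφ := (hφ.1.differentiableAt_of_isOpen hV hy).hasFDerivAt
  have dx : ∀ (i : Fin 3), HasFDerivAt (fun z : Vec3 => z i) _ y := fun i =>
    hasFDerivAt_apply (𝕜 := ℝ) i y
  obtain ⟨hρ, h0, h1⟩ := hφ.2 y hy
  set u := (helicalField k).η 0 y with hu
  have hu0 : u 0 = -y 1 := rfl
  have hu1 : u 1 = y 0 := rfl
  have hu2 : u 2 = k := rfl
  -- The angle is known only through `x = ρ cos φ` and `y = ρ sin φ`. Differentiating both along the
  -- generator and solving the resulting system gives derivative `0` for `ρ` and `1` for `φ`.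
  have e0 : (fun z : Vec3 => cylRadius z * Real.cos (φ z)) =ᶠ[nhds y] fun z => z 0 := by
    filter_upwards [hV.mem_nhds hy] with z hz using (hφ.2 z hz).2.1.symm
  have e1 : (fun z : Vec3 => cylRadius z * Real.sin (φ z)) =ᶠ[nhds y] fun z => z 1 := by
    filter_upwards [hV.mem_nhds hy] with z hz using (hφ.2 z hz).2.2.symm
  have d0 := congrArg (fun f => f u) (((dρ.fun_mul dφ.cos).congr_of_eventuallyEq e0.symm).unique
    (dx 0))
  have d1 := congrArg (fun f => f u) (((dρ.fun_mul dφ.sin).congr_of_eventuallyEq e1.symm).unique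
    (dx 1))
  simp [hu0, hu1] at d0 d1
  set a := fderiv ℝ cylRadius y u
  set b := fderiv ℝ φ y u
  have hcs := Real.sin_sq_add_cos_sq (φ y)
  have ha : a = 0 := by
    linear_combination Real.cos (φ y) * d0 + Real.sin (φ y) * d1 - a * hcs
      - Real.cos (φ y) * h1 + Real.sin (φ y) * h0
  have hb : b = 1 := by
    have : cylRadius y * (b - 1) = 0 := by
      linear_combination Real.cos (φ y) * d1 - Real.sin (φ y) * d0
        + (cylRadius y - cylRadius y * b) * hcs + Real.cos (φ y) * h0 + Real.sin (φ y) * h1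
    rcases mul_eq_zero.1 this with h | h
    · exact absurd h hρ.ne'
    · linarith
  have hd : HasFDerivAt (helicalCoords k φ) _ y := dρ.prodMk ((dx 2).fun_sub (dφ.const_mul k))
  rw [hd.fderiv]
  simp only [ContinuousLinearMap.prod_apply, _root_.sub_apply, _root_.smul_apply,
    ContinuousLinearMap.proj_apply, smul_eq_mul, hu2]
  change (a, k - k * b) = 0
  rw [ha, hb]
  simp

/-- All the coefficient functions are constant along the generator, so the potentials are exactly
invariant and `admits_of_mapsPotentials` applies. The existence of a polar angle keeps the set off
the `z`-axis, so the generator does not vanish even for `k = 0`. -/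
theorem exists_admits_of_helical {T : EquivTransf} {k : ℝ} {U : Set Vec3} (hU : IsOpen U)
    {A : Vec3 → Vec3} {Φ : Vec3 → ℝ} (hS : SmoothPotentials U A Φ) {J : Vec3 → Vec3 → ℝ}
    (h : ReducesToHelical T k U A Φ J) :
    ∃ X : PointField, T.MapsField U X (helicalField k) ∧
      AdmitsInvolutiveIntegral U A Φ X (fun _ => J) := by
  obtain ⟨g, φ, F₁, F₂, F₃, G, A', Φ', hmap, ⟨hφ, ⟨W, hW, hVW, s₁, s₂, s₃, sG⟩, hcase⟩, hJ⟩ := h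
  have hV := T.isOpen_image_pos hU
  set V := T.pos '' U with hVdef
  have shc := hφ.contDiffOn_helicalCoords k
  have dx : ∀ (y : Vec3) (i : Fin 3), HasFDerivAt (fun z : Vec3 => z i) _ y := fun y i =>
    hasFDerivAt_apply (𝕜 := ℝ) i y
  have sx : ∀ i : Fin 3, ContDiffOn ℝ ∞ (fun z : Vec3 => z i) V := fun i =>
    (contDiff_apply ℝ ℝ i).contDiffOn
  have hF : ∀ F : ℝ × ℝ → ℝ, ContDiffOn ℝ ∞ F W →
      ContDiffOn ℝ ∞ (fun y => F (helicalCoords k φ y)) V ∧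
      ∀ y ∈ V, fderiv ℝ (fun y => F (helicalCoords k φ y)) y ((helicalField k).η 0 y) = 0 := by
    refine fun F sF => ⟨sF.comp shc hVW, fun y hy => ?_⟩
    have := (sF.differentiableAt_of_isOpen hW (hVW y hy)).hasFDerivAt.comp y
      (shc.differentiableAt_of_isOpen hV hy).hasFDerivAt
    have h2 : fderiv ℝ (fun y => F (helicalCoords k φ y)) y = _ := this.fderiv
    rw [h2, ContinuousLinearMap.comp_apply, fderiv_helicalCoords hV hφ hy, map_zero]
  obtain ⟨c₁, e₁⟩ := hF F₁ s₁
  obtain ⟨c₂, e₂⟩ := hF F₂ s₂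
  obtain ⟨c₃, e₃⟩ := hF F₃ s₃
  obtain ⟨cG, eG⟩ := hF G sG
  have sA' : ContDiffOn ℝ ∞ A' V := by
    refine contDiffOn_pi.2 fun i => ?_
    fin_cases i
    · exact (((sx 0).mul c₁).sub ((sx 1).mul c₂)).congr fun y hy => (hcase y hy).1
    · exact (((sx 1).mul c₁).add ((sx 0).mul c₂)).congr fun y hy => (hcase y hy).2.1
    · exact c₃.congr fun y hy => (hcase y hy).2.2.1
  refine ⟨_, mapsField_of_pullback T U (Y := helicalField k) (fun _ _ => rfl) fun _ _ => rfl,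
    admits_of_mapsPotentials hU hS hmap (contDiff_helicalField k 0) (helicalField_skew k 0)
      (fun y hy h0 => ?_) sA' (cG.congr fun y hy => (hcase y hy).2.2.2) (fun y hy => ?_)
      (fun y hy v => ?_) fun x hx v => ?_⟩
  · have h1 : -y 1 = 0 := congrFun h0 0
    have h2 : y 0 = 0 := congrFun h0 1
    have := (hφ.2 y hy).1
    rw [cylRadius, h2, neg_eq_zero.1 h1] at this
    simp at this
  · have : Φ' =ᶠ[nhds y] fun y => G (helicalCoords k φ y) := by
      filter_upwards [hV.mem_nhds hy] with z hz using (hcase z hz).2.2.2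
    rw [this.fderiv_eq, eG y hy]
  · have dA := sA'.differentiableAt_of_isOpen hV hy
    have d₁ := (c₁.differentiableAt_of_isOpen hV hy).hasFDerivAt
    have d₂ := (c₂.differentiableAt_of_isOpen hV hy).hasFDerivAt
    have hu0 : (helicalField k).η 0 y 0 = -y 1 := rfl
    have hu1 : (helicalField k).η 0 y 1 = y 0 := rfl
    obtain ⟨a0, a1, a2, -⟩ := hcase y hy
    have b0 : fderiv ℝ A' y ((helicalField k).η 0 y) 0 = -A' y 1 := by
      have : (fun z => A' z 0) =ᶠ[nhds y]
          fun z => z 0 * F₁ (helicalCoords k φ z) - z 1 * F₂ (helicalCoords k φ z) := by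
        filter_upwards [hV.mem_nhds hy] with z hz using (hcase z hz).1
      rw [← fderiv_component dA, this.fderiv_eq,
        (((dx y 0).fun_mul d₁).fun_sub ((dx y 1).fun_mul d₂)).fderiv]
      simp [e₁ y hy, e₂ y hy, hu0, hu1, a1]
      ring
    have b1 : fderiv ℝ A' y ((helicalField k).η 0 y) 1 = A' y 0 := by
      have : (fun z => A' z 1) =ᶠ[nhds y]
          fun z => z 1 * F₁ (helicalCoords k φ z) + z 0 * F₂ (helicalCoords k φ z) := by
        filter_upwards [hV.mem_nhds hy] with z hz using (hcase z hz).2.1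
      rw [← fderiv_component dA, this.fderiv_eq,
        (((dx y 1).fun_mul d₁).fun_add ((dx y 0).fun_mul d₂)).fderiv]
      simp [e₁ y hy, e₂ y hy, hu0, hu1, a0]
      ring
    have b2 : fderiv ℝ A' y ((helicalField k).η 0 y) 2 = 0 := by
      have : (fun z => A' z 2) =ᶠ[nhds y]
          fun z => F₃ (helicalCoords k φ z) := by
        filter_upwards [hV.mem_nhds hy] with z hz using (hcase z hz).2.2.1
      rw [← fderiv_component dA, this.fderiv_eq, e₃ y hy]
    rw [fderiv_helicalField]
    simp only [dotProduct, Fin.sum_univ_three, b0, b1, b2, Matrix.cons_val_zero, Matrix.cons_val_one,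
      Matrix.cons_val]
    ring
  · obtain ⟨a0, a1, a2, -⟩ := hcase _ (Set.mem_image_of_mem T.pos hx)
    rw [hJ x hx v, helicalIntegral_eq_dotProduct a0 a1 a2 0]

theorem exists_admits_of_translational {T : EquivTransf} {U : Set Vec3} (hU : IsOpen U)
    {A : Vec3 → Vec3} {Φ : Vec3 → ℝ} (hS : SmoothPotentials U A Φ) {J : Vec3 → Vec3 → ℝ}
    (h : ReducesToTranslational T U A Φ J) :
    ∃ X : PointField, T.MapsField U X translationalField ∧
      AdmitsInvolutiveIntegral U A Φ X (fun _ => J) := by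
  obtain ⟨g, F₁, F₂, F₃, G, A', Φ', hmap, ⟨⟨W, hW, hVW, s₁, s₂, s₃, sG⟩, hcase⟩, hJ⟩ := h
  have hV := T.isOpen_image_pos hU
  set V := T.pos '' U with hVdef
  have hF : ∀ F : ℝ × ℝ → ℝ, ContDiffOn ℝ ∞ F W →
      ContDiffOn ℝ ∞ (fun y : Vec3 => F (y 0, y 1)) V ∧
      ∀ y ∈ V, fderiv ℝ (fun y : Vec3 => F (y 0, y 1)) y (translationalField.η 0 y) = 0 := by
    refine fun F sF => ⟨sF.comp (by fun_prop) hVW, fun y hy => ?_⟩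
    have := (sF.differentiableAt_of_isOpen hW (hVW y hy)).hasFDerivAt.comp y
      ((hasFDerivAt_apply (𝕜 := ℝ) (0 : Fin 3) y).prodMk (hasFDerivAt_apply (𝕜 := ℝ) (1 : Fin 3) y))
    have h2 : fderiv ℝ (fun y : Vec3 => F (y 0, y 1)) y = _ := this.fderiv
    rw [h2]
    exact map_zero (fderiv ℝ F (y 0, y 1))
  have sA' : ContDiffOn ℝ ∞ A' V := by
    refine contDiffOn_pi.2 fun i => ?_
    fin_cases i
    · exact (hF F₁ s₁).1.congr fun y hy => (hcase y hy).1
    · exact (hF F₂ s₂).1.congr fun y hy => (hcase y hy).2.1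
    · exact (hF F₃ s₃).1.congr fun y hy => (hcase y hy).2.2.1
  refine ⟨_, mapsField_of_pullback T U (Y := translationalField) (fun _ _ => rfl) fun _ _ => rfl,
    admits_of_mapsPotentials hU hS hmap (contDiff_translationalField 0)
      (fun y v => by rw [fderiv_translationalField, zero_dotProduct])
      (fun y hy h0 => one_ne_zero (congrFun h0 2)) sA'
      ((hF G sG).1.congr fun y hy => (hcase y hy).2.2.2) (fun y hy => ?_)
      (fun y hy v => ?_) fun x hx v => ?_⟩
  · have : Φ' =ᶠ[nhds y] fun y : Vec3 => G (y 0, y 1) := by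
      filter_upwards [hV.mem_nhds hy] with z hz using (hcase z hz).2.2.2
    rw [this.fderiv_eq, (hF G sG).2 y hy]
  · have dA := sA'.differentiableAt_of_isOpen hV hy
    have b : fderiv ℝ A' y (translationalField.η 0 y) = 0 := by
      funext i
      rw [← fderiv_component dA]
      fin_cases i
      · have : (fun z => A' z 0) =ᶠ[nhds y] fun z => F₁ (z 0, z 1) := by
          filter_upwards [hV.mem_nhds hy] with z hz using (hcase z hz).1
        change fderiv ℝ (fun z => A' z 0) y (translationalField.η 0 y) = 0
        rw [this.fderiv_eq, (hF F₁ s₁).2 y hy]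
      · have : (fun z => A' z 1) =ᶠ[nhds y] fun z => F₂ (z 0, z 1) := by
          filter_upwards [hV.mem_nhds hy] with z hz using (hcase z hz).2.1
        change fderiv ℝ (fun z => A' z 1) y (translationalField.η 0 y) = 0
        rw [this.fderiv_eq, (hF F₂ s₂).2 y hy]
      · have : (fun z => A' z 2) =ᶠ[nhds y] fun z => F₃ (z 0, z 1) := by
          filter_upwards [hV.mem_nhds hy] with z hz using (hcase z hz).2.2.1
        change fderiv ℝ (fun z => A' z 2) y (translationalField.η 0 y) = 0
        rw [this.fderiv_eq, (hF F₃ s₃).2 y hy]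
    rw [b, fderiv_translationalField, zero_dotProduct, dotProduct_zero, add_zero]
  · rw [hJ x hx v, translationalIntegral_eq_dotProduct
      (hcase _ (Set.mem_image_of_mem T.pos hx)).2.2.1 0]

/-! ### Inequivalence of the two cases -/

/-- A helical generator is never equivalent to a translation. -/
theorem not_mapsField_helical_translational (k : ℝ) (T : EquivTransf) {U : Set Vec3}
    (hU : IsOpen U) (hne : U.Nonempty) : ¬ T.MapsField U (helicalField k) translationalField := by
  rintro ⟨α, β, -, h⟩
  obtain ⟨p, hp⟩ := hne
  obtain ⟨ε, hε, hball⟩ := Metric.isOpen_iff.1 hU p hp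
  -- The second component of the helical generator is `x`, so it takes different values at these two
  -- points, whereas the translational generator takes the same value at their images.
  have hq : p + Pi.single 0 (ε / 2) ∈ U := hball (by
    rw [Metric.mem_ball, dist_eq_norm, add_sub_cancel_left, Pi.norm_single, Real.norm_eq_abs,
      abs_of_pos (by linarith)]
    linarith)
  have h1 : T.scaleX • (T.rot *ᵥ (helicalField k).η 0 p)
      = T.scaleX • (T.rot *ᵥ (helicalField k).η 0 (p + Pi.single 0 (ε / 2))) :=
    (h 0 p hp).2.trans (h 0 _ hq).2.symm
  have h2 := congrArg (fun v => T.rotᵀ *ᵥ v) (smul_right_injective _ T.scaleX_ne h1)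
  simp only [T.transpose_rot_mulVec] at h2
  have h3 : p 0 = p 0 + ε / 2 := by simpa [helicalField] using congrFun h2 1
  linarith

theorem IsOpen.eventually_mem_line {U : Set Vec3} (hU : IsOpen U) {p : Vec3} (hp : p ∈ U) (d : Vec3) :
    ∀ᶠ s in nhds (0 : ℝ), p + s • d ∈ U := by
  have hc : Continuous fun s : ℝ => p + s • d := by fun_prop
  exact hc.continuousAt.eventually (hU.mem_nhds (by simpa using hp))

/-- A reduction to one of the two cases gives a direction of invariance of `Φ`. -/
theorem fderiv_of_admits {U : Set Vec3} (hU : IsOpen U) {A : Vec3 → Vec3} {Φ : Vec3 → ℝ}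
    (hS : SmoothPotentials U A Φ) {X : PointField} {I : ℝ → Vec3 → Vec3 → ℝ}
    (h : AdmitsInvolutiveIntegral U A Φ X I) {x : Vec3} (hx : x ∈ U) :
    fderiv ℝ Φ x (X.η 0 x) = 0 := by
  obtain ⟨⟨σ, hN, hI⟩, -, -, hB⟩ := h
  exact (involutive_noether_at hU hS hN hI hB 0 hx).2.2.2.2.1

theorem SmoothPotentials.mono {U U' : Set Vec3} {A : Vec3 → Vec3} {Φ : Vec3 → ℝ}
    (h : SmoothPotentials U A Φ) (hU : U' ⊆ U) : SmoothPotentials U' A Φ :=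
  ⟨h.1.mono hU, h.2.mono hU⟩

/-- An obstruction in terms of `Φ` alone: the converse direction turns the reduction into an
involutive integral, whose field annihilates `Φ`. That field is proportional to the rotated-back
`z`-direction, which serves as `c`. -/
theorem exists_translation_of_reduces {T : EquivTransf} {U : Set Vec3} (hU : IsOpen U)
    {A : Vec3 → Vec3} {Φ : Vec3 → ℝ} (hS : SmoothPotentials U A Φ) {J : Vec3 → Vec3 → ℝ}
    (h : ReducesToTranslational T U A Φ J) :
    ∃ c : Vec3, c ≠ 0 ∧ ∀ x ∈ U, fderiv ℝ Φ x c = 0 := by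
  obtain ⟨X, ⟨α, β, hα, hX⟩, hadm⟩ := exists_admits_of_translational hU hS h
  let e : Vec3 := ![0, 0, 1]
  have he : e ≠ 0 := fun h => one_ne_zero (congrFun h 2)
  have hη : ∀ x ∈ U, T.rotᵀ *ᵥ e = (α⁻¹ * T.scaleX) • X.η 0 x := fun x hx => by
    have h1 : T.scaleX • (T.rot *ᵥ X.η 0 x) = α • e := (hX 0 x hx).2
    have h2 : e = (α⁻¹ * T.scaleX) • (T.rot *ᵥ X.η 0 x) := by
      rw [mul_smul, h1, smul_smul, inv_mul_cancel₀ hα, one_smul]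
    rw [h2, Matrix.mulVec_smul, T.transpose_rot_mulVec]
  refine ⟨T.rotᵀ *ᵥ e, fun h0 => he ?_, fun x hx => ?_⟩
  · rw [← T.rot_transpose_mulVec e, h0, Matrix.mulVec_zero]
  · rw [hη x hx, map_smul, fderiv_of_admits hU hS hadm hx, smul_zero]

/-- As in the translational case, with the rotated-back helical generator, which is affine with skew
linear part `M`. -/
theorem exists_screw_of_reduces {T : EquivTransf} {k : ℝ} {U : Set Vec3} (hU : IsOpen U)
    {A : Vec3 → Vec3} {Φ : Vec3 → ℝ} (hS : SmoothPotentials U A Φ) {J : Vec3 → Vec3 → ℝ}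
    (h : ReducesToHelical T k U A Φ J) :
    ∃ c w : Vec3, w ≠ 0 ∧ ∀ x ∈ U, fderiv ℝ Φ x (c + crossProduct w x) = 0 := by
  obtain ⟨X, ⟨α, β, hα, hX⟩, hadm⟩ := exists_admits_of_helical hU hS h
  have hX0 := T.scaleX_ne
  let η : Vec3 → Vec3 := fun x => T.rotᵀ *ᵥ (helicalField k).η 0 (T.pos x)
  have hη : ∀ x ∈ U, fderiv ℝ Φ x (η x) = 0 := fun x hx => by
    have h2 : (helicalField k).η 0 (T.pos x) = (α⁻¹ * T.scaleX) • (T.rot *ᵥ X.η 0 x) := by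
      have h1 : T.scaleX • (T.rot *ᵥ X.η 0 x) = α • (helicalField k).η 0 (T.pos x) := by
        simpa [helicalField] using (hX 0 x hx).2
      rw [mul_smul, h1, smul_smul, inv_mul_cancel₀ hα, one_smul]
    change fderiv ℝ Φ x (T.rotᵀ *ᵥ (helicalField k).η 0 (T.pos x)) = 0
    rw [h2, Matrix.mulVec_smul, T.transpose_rot_mulVec, map_smul,
      fderiv_of_admits hU hS hadm hx, smul_zero]
  let M : Vec3 →L[ℝ] Vec3 := T.rotInvL.comp ((fderiv ℝ ((helicalField k).η 0) 0).comp
    (T.scaleX • T.rotL))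
  have hM : ∀ v, M v ⬝ᵥ v = 0 := fun v => by
    have h1 := helicalField_skew k 0 0 (T.rot *ᵥ v)
    simp only [M, ContinuousLinearMap.comp_apply, T.rotInvL_apply, T.transpose_mulVec_dotProduct,
      _root_.smul_apply, map_smul, T.rotL_apply, smul_dotProduct, Matrix.mulVec_smul, h1, smul_zero]
  obtain ⟨w, hw⟩ := exists_crossProduct_of_skew M hM
  have haff : ∀ x, η x = η 0 + crossProduct w x := fun x => by
    have h1 : T.pos x = T.scaleX • (T.rot *ᵥ x) + T.pos 0 := by
      simp [EquivTransf.pos]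
    have h2 : (helicalField k).η 0 (T.scaleX • (T.rot *ᵥ x) + T.pos 0) = (helicalField k).η 0 (T.pos 0)
        + fderiv ℝ ((helicalField k).η 0) 0 (T.scaleX • (T.rot *ᵥ x)) := by
      rw [fderiv_helicalField]
      funext i
      fin_cases i <;> simp [helicalField] <;> ring
    rw [← hw]
    simp only [η, M, h1, h2, Matrix.mulVec_add]
    rfl
  refine ⟨η 0, w, fun h0 => ?_, fun x hx => haff x ▸ hη x hx⟩
  -- In the rotated frame the linear part sends the first basis vector to the second, up to the
  -- scale factor removed here; so it is not zero, and neither is `w`.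
  have h1 : M (T.rotInvL (T.scaleX⁻¹ • ![1, 0, 0])) = T.rotᵀ *ᵥ ![0, 1, 0] := by
    simp only [M, ContinuousLinearMap.comp_apply, T.rotInvL_apply, Matrix.mulVec_smul,
      _root_.smul_apply, map_smul, T.rotL_apply, T.rot_transpose_mulVec, smul_smul,
      inv_mul_cancel₀ hX0, one_smul, fderiv_helicalField]
    congr 1
    funext i
    fin_cases i <;> simp
  rw [hw, h0, map_zero, LinearMap.zero_apply] at h1
  have h2 := congrArg (fun v => (T.rot *ᵥ v) 1) h1
  simp only [T.rot_transpose_mulVec, Matrix.mulVec_zero] at h2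
  simp at h2

/-! ### Examples -/

/-- The four points `0`, `± ε / 3` and `2 ε / 3` lie in the ball of radius `ε`, and a cubic
vanishing at four points is zero. -/
theorem cubic_coeff_eq_zero_of_eventually {a b c d : ℝ}
    (h : ∀ᶠ s in nhds (0 : ℝ), a + b * s + c * s ^ 2 + d * s ^ 3 = 0) :
    a = 0 ∧ b = 0 ∧ c = 0 ∧ d = 0 := by
  obtain ⟨ε, hε, hball⟩ := Metric.eventually_nhds_iff.1 h
  have hs : ∀ m : ℝ, |m| ≤ 2 → a + (b * (ε / 3)) * m + (c * (ε / 3) ^ 2) * m ^ 2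
      + (d * (ε / 3) ^ 3) * m ^ 3 = 0 := fun m hm => by
    have := hball (y := m * (ε / 3)) (by
      rw [Real.dist_eq, sub_zero, abs_mul, abs_of_pos (by linarith : 0 < ε / 3)]
      nlinarith)
    linear_combination this
  have h0 := hs 0 (by norm_num)
  have h1 := hs 1 (by norm_num)
  have h2 := hs (-1) (by norm_num)
  have h3 := hs 2 (by norm_num)
  have hp : ∀ n : ℕ, (ε / 3) ^ n ≠ 0 := fun n => pow_ne_zero n (by linarith)
  refine ⟨by linarith, ?_, ?_, ?_⟩
  · exact (mul_eq_zero.1 (show b * (ε / 3) = 0 by linarith)).resolve_right (by linarith)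
  · exact (mul_eq_zero.1 (show c * (ε / 3) ^ 2 = 0 by linarith)).resolve_right (hp 2)
  · exact (mul_eq_zero.1 (show d * (ε / 3) ^ 3 = 0 by linarith)).resolve_right (hp 3)

/-- The derivative of the polar angle. -/
theorem IsPolarAngle.fderiv_mul {V : Set Vec3} (hV : IsOpen V) {φ : Vec3 → ℝ}
    (hφ : IsPolarAngle V φ) {y : Vec3} (hy : y ∈ V) (u : Vec3) :
    fderiv ℝ φ y u * (y 0 ^ 2 + y 1 ^ 2) = y 0 * u 1 - y 1 * u 0 := by
  have sρ := contDiffOn_cylRadius fun x hx => (hφ.2 x hx).1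
  have dρ := (sρ.differentiableAt_of_isOpen hV hy).hasFDerivAt
  have dφ := (hφ.1.differentiableAt_of_isOpen hV hy).hasFDerivAt
  have dx : ∀ (i : Fin 3), HasFDerivAt (fun z : Vec3 => z i) _ y := fun i =>
    hasFDerivAt_apply (𝕜 := ℝ) i y
  obtain ⟨hρ, h0, h1⟩ := hφ.2 y hy
  have e0 : (fun z : Vec3 => cylRadius z * Real.cos (φ z)) =ᶠ[nhds y] fun z => z 0 := by
    filter_upwards [hV.mem_nhds hy] with z hz using (hφ.2 z hz).2.1.symm
  have e1 : (fun z : Vec3 => cylRadius z * Real.sin (φ z)) =ᶠ[nhds y] fun z => z 1 := by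
    filter_upwards [hV.mem_nhds hy] with z hz using (hφ.2 z hz).2.2.symm
  have d0 := congrArg (fun f => f u) (((dρ.fun_mul dφ.cos).congr_of_eventuallyEq e0.symm).unique
    (dx 0))
  have d1 := congrArg (fun f => f u) (((dρ.fun_mul dφ.sin).congr_of_eventuallyEq e1.symm).unique
    (dx 1))
  simp at d0 d1
  rw [h0, h1, ← d0, ← d1]
  ring

/-- A family of vector potentials with inhomogeneous and curved magnetic fields. -/
def samplePotential (m : ℝ) (x : Vec3) : Vec3 := ![-m * x 1, x 0, x 0 ^ 2 + x 1 ^ 2]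

theorem contDiff_samplePotential (m : ℝ) : ContDiff ℝ ∞ (samplePotential m) := by
  refine contDiff_pi.2 fun i => ?_
  fin_cases i <;> simp [samplePotential] <;> fun_prop

theorem curl3_samplePotential (m : ℝ) (x : Vec3) :
    curl3 (samplePotential m) x = ![2 * x 1, -(2 * x 0), 1 + m] := by
  have dx : ∀ (i : Fin 3), HasFDerivAt (fun z : Vec3 => z i) _ x := fun i =>
    hasFDerivAt_apply (𝕜 := ℝ) i x
  have e0 : fderiv ℝ (fun y => samplePotential m y 0) x = _ := ((dx 1).const_mul (-m)).fderiv
  have e1 : fderiv ℝ (fun y => samplePotential m y 1) x = _ := (dx 0).fderiv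
  have e2 : fderiv ℝ (fun y => samplePotential m y 2) x = _ :=
    (((dx 0).pow 2).fun_add ((dx 1).pow 2)).fderiv
  simp only [curl3, pderiv3, e0, e1, e2]
  funext i
  fin_cases i <;> simp

/-- On the `x`-axis the `z`-component of the field is the non-zero constant `1 + m` while the
`y`-component varies, so the fields at two points are not parallel. -/
theorem inhomogeneousCurved_samplePotential {m : ℝ} (hm : 1 + m ≠ 0) {U : Set Vec3}
    (h1 : ![1, 0, 0] ∈ U) (h2 : ![2, 0, 0] ∈ U) : InhomogeneousCurved U (samplePotential m) := by
  constructor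
  · rintro ⟨B, hB⟩
    have := congrFun ((hB _ h1).trans (hB _ h2).symm) 1
    simp [curl3_samplePotential] at this
  · rintro ⟨n, hn⟩
    obtain ⟨a, ha⟩ := hn _ h1
    obtain ⟨b, hb⟩ := hn _ h2
    rw [curl3_samplePotential] at ha hb
    have ha1 : -(2 * (1 : ℝ)) = a * n 1 := congrFun ha 1
    have ha2 : 1 + m = a * n 2 := congrFun ha 2
    have hb1 : -(2 * (2 : ℝ)) = b * n 1 := congrFun hb 1
    have hb2 : 1 + m = b * n 2 := congrFun hb 2
    have hn2 : n 2 ≠ 0 := fun h => hm (by rw [ha2, h, mul_zero])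
    have hab : a = b := mul_right_cancel₀ hn2 (ha2.symm.trans hb2)
    rw [hab] at ha1
    linarith

/-- The identity transformation. -/
def EquivTransf.refl : EquivTransf :=
  ⟨1, one_mem _, 1, one_ne_zero, 1, one_ne_zero, 0, 0, 0⟩

@[simp] theorem EquivTransf.refl_pos (x : Vec3) : EquivTransf.refl.pos x = x := by
  simp [EquivTransf.refl, EquivTransf.pos]

theorem EquivTransf.refl_mapsPotentials (U : Set Vec3) (A : Vec3 → Vec3) (Φ : Vec3 → ℝ) :
    EquivTransf.refl.MapsPotentials (fun _ => 0) U A Φ A Φ := by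
  refine ⟨contDiffOn_const, fun x _ => ⟨?_, ?_⟩⟩
  · have : ∀ y, grad3 (fun _ => (0 : ℝ)) y = 0 := fun y => eq_of_forall_dotProduct fun v => by
      rw [grad3_dotProduct, fderiv_fun_const]; simp
    rw [EquivTransf.refl_pos, this]
    simp [EquivTransf.refl]
  · rw [EquivTransf.refl_pos]
    simp [EquivTransf.refl]

theorem EquivTransf.refl_image (U : Set Vec3) : EquivTransf.refl.pos '' U = U := by
  rw [show EquivTransf.refl.pos = id from funext EquivTransf.refl_pos, Set.image_id]

/-- The sample vector potential with `m = 1` is invariant under rotations about and translations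
along the `z`-axis, so only `Φ = ρ² + (z - k φ)` obstructs. The half-space carries a smooth polar
angle and is convex, hence connected. -/
theorem exists_helical_not_translational (k : ℝ) :
    ∃ (U : Set Vec3) (A : Vec3 → Vec3) (Φ : Vec3 → ℝ),
      IsOpen U ∧ IsConnected U ∧ SmoothPotentials U A Φ ∧ InhomogeneousCurved U A ∧
      (∃ T J, ReducesToHelical T k U A Φ J) ∧
      ∀ U' ⊆ U, IsOpen U' → U'.Nonempty → ¬ ∃ T J, ReducesToTranslational T U' A Φ J := by
  set U := polarHalfSpace 0
  set φ := polarBranch 0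
  have hU : IsOpen U := isOpen_polarHalfSpace 0
  have hφ : IsPolarAngle U φ := isPolarAngle_polarBranch 0
  have hmem : ∀ r : ℝ, 0 < r → ![r, 0, 0] ∈ U := fun r hr => by
    simpa [U, polarHalfSpace] using hr
  have hconv : Convex ℝ U := by
    have : U = {y : Vec3 | 0 < (ContinuousLinearMap.proj (R := ℝ) (φ := fun _ : Fin 3 => ℝ) 0) y} := by
      ext y; simp [U, polarHalfSpace]
    rw [this]
    exact convex_halfSpace_gt (LinearMap.isLinear _) 0
  have hcyl : ∀ y, cylRadius y ^ 2 = y 0 ^ 2 + y 1 ^ 2 := fun y => Real.sq_sqrt (by positivity)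
  let Φ : Vec3 → ℝ := fun y => y 0 ^ 2 + y 1 ^ 2 + (y 2 - k * φ y)
  have hS : SmoothPotentials U (samplePotential 1) Φ := by
    refine ⟨(contDiff_samplePotential 1).contDiffOn, ?_⟩
    have := hφ.1
    fun_prop
  refine ⟨U, samplePotential 1, Φ, hU, ⟨⟨_, hmem 1 one_pos⟩, hconv.isPreconnected⟩, hS,
    inhomogeneousCurved_samplePotential (by norm_num) (hmem 1 one_pos) (hmem 2 two_pos),
    ⟨EquivTransf.refl, _, fun _ => 0, φ, fun _ => 0, fun _ => 1, fun q => q.1 ^ 2,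
      fun q => q.1 ^ 2 + q.2, _, _, EquivTransf.refl_mapsPotentials _ _ _, ?_, fun _ _ _ => rfl⟩, ?_⟩
  · rw [EquivTransf.refl_image]
    refine ⟨hφ, ⟨Set.univ, isOpen_univ, fun _ _ => trivial, contDiffOn_const, contDiffOn_const,
      by fun_prop, by fun_prop⟩, fun y _ => ?_⟩
    simp [samplePotential, helicalCoords, hcyl, Φ]
  · rintro U' hU' hoU' ⟨p, hp⟩ ⟨T, J, h⟩
    obtain ⟨c, hc, hcΦ⟩ := exists_translation_of_reduces hoU' (hS.mono hU') h
    -- Multiplying `c · ∇Φ = 0` by `ρ²` clears the denominator of `∇φ` and leaves a polynomial. Its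
    -- cubic coefficients along the `x`- and `y`-directions are `2 c₀` and `2 c₁`; `c₂` then follows
    -- from `ρ ≠ 0`.
    have key : ∀ y ∈ U', (2 * y 0 * c 0 + 2 * y 1 * c 1 + c 2) * (y 0 ^ 2 + y 1 ^ 2)
        - k * (y 0 * c 1 - y 1 * c 0) = 0 := fun y hy => by
      have dx : ∀ (i : Fin 3), HasFDerivAt (fun z : Vec3 => z i) _ y := fun i =>
        hasFDerivAt_apply (𝕜 := ℝ) i y
      have dφ := (hφ.1.differentiableAt_of_isOpen hU (hU' hy)).hasFDerivAt
      have dΦ : HasFDerivAt Φ _ y := (((dx 0).pow 2).fun_add ((dx 1).pow 2)).fun_add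
        ((dx 2).fun_sub (dφ.const_mul k))
      have h1 := hcΦ y hy
      rw [dΦ.fderiv] at h1
      simp at h1
      have h2 := hφ.fderiv_mul hU (hU' hy) c
      linear_combination (y 0 ^ 2 + y 1 ^ 2) * h1 + k * h2
    have c0 : c 0 = 0 := by
      have := cubic_coeff_eq_zero_of_eventually
        (a := (2 * p 0 * c 0 + 2 * p 1 * c 1 + c 2) * (p 0 ^ 2 + p 1 ^ 2)
          - k * (p 0 * c 1 - p 1 * c 0))
        (b := 2 * c 0 * (p 0 ^ 2 + p 1 ^ 2) + (2 * p 0 * c 0 + 2 * p 1 * c 1 + c 2) * (2 * p 0)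
          - k * c 1)
        (c := 2 * c 0 * (2 * p 0) + (2 * p 0 * c 0 + 2 * p 1 * c 1 + c 2)) (d := 2 * c 0) (by
          filter_upwards [hoU'.eventually_mem_line hp ![1, 0, 0]] with s hs
          have := key _ hs
          simp at this
          linear_combination this)
      linarith [this.2.2.2]
    have c1 : c 1 = 0 := by
      have := cubic_coeff_eq_zero_of_eventually
        (a := (2 * p 0 * c 0 + 2 * p 1 * c 1 + c 2) * (p 0 ^ 2 + p 1 ^ 2)
          - k * (p 0 * c 1 - p 1 * c 0))
        (b := 2 * c 1 * (p 0 ^ 2 + p 1 ^ 2) + (2 * p 0 * c 0 + 2 * p 1 * c 1 + c 2) * (2 * p 1)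
          + k * c 0)
        (c := 2 * c 1 * (2 * p 1) + (2 * p 0 * c 0 + 2 * p 1 * c 1 + c 2)) (d := 2 * c 1) (by
          filter_upwards [hoU'.eventually_mem_line hp ![0, 1, 0]] with s hs
          have := key _ hs
          simp at this
          linear_combination this)
      linarith [this.2.2.2]
    have hρ : p 0 ^ 2 + p 1 ^ 2 ≠ 0 := (Real.sqrt_pos.1 (hφ.2 p (hU' hp)).1).ne'
    have c2 : c 2 = 0 := by
      have := key p hp
      rw [c0, c1] at this
      exact (mul_eq_zero.1 (by linear_combination this : c 2 * (p 0 ^ 2 + p 1 ^ 2) = 0)).resolve_right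
        hρ
    exact hc (by funext i; fin_cases i <;> assumption)

/-- The level sets of `Φ = x + y²` are parabolic cylinders, which no infinitesimal screw motion with
a rotational part preserves, even locally. -/
theorem exists_translational_not_helical :
    ∃ (U : Set Vec3) (A : Vec3 → Vec3) (Φ : Vec3 → ℝ),
      IsOpen U ∧ IsConnected U ∧ SmoothPotentials U A Φ ∧ InhomogeneousCurved U A ∧
      (∃ T J, ReducesToTranslational T U A Φ J) ∧
      ∀ U' ⊆ U, IsOpen U' → U'.Nonempty → ¬ ∃ T k J, ReducesToHelical T k U' A Φ J := by
  let Φ : Vec3 → ℝ := fun y => y 0 + y 1 ^ 2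
  have hS : SmoothPotentials Set.univ (samplePotential 0) Φ :=
    ⟨(contDiff_samplePotential 0).contDiffOn, by fun_prop⟩
  refine ⟨Set.univ, samplePotential 0, Φ, isOpen_univ, isConnected_univ, hS,
    inhomogeneousCurved_samplePotential (by norm_num) trivial trivial,
    ⟨EquivTransf.refl, _, fun _ => 0, fun _ => 0, fun q => q.1, fun q => q.1 ^ 2 + q.2 ^ 2,
      fun q => q.1 + q.2 ^ 2, _, _, EquivTransf.refl_mapsPotentials _ _ _,
      ⟨⟨Set.univ, isOpen_univ, fun _ _ => trivial, contDiffOn_const, by fun_prop, by fun_prop,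
        by fun_prop⟩, fun y _ => by simp [samplePotential, Φ]⟩, fun _ _ _ => rfl⟩, ?_⟩
  rintro U' hU' hoU' ⟨p, hp⟩ ⟨T, k, J, h⟩
  obtain ⟨c, w, hw, hcw⟩ := exists_screw_of_reduces hoU' (hS.mono hU') h
  have key : ∀ y ∈ U', c 0 + (w 1 * y 2 - w 2 * y 1)
      + 2 * y 1 * (c 1 + (w 2 * y 0 - w 0 * y 2)) = 0 := fun y hy => by
    have dΦ : HasFDerivAt Φ _ y := (hasFDerivAt_apply (𝕜 := ℝ) (0 : Fin 3) y).fun_add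
      ((hasFDerivAt_apply (𝕜 := ℝ) (1 : Fin 3) y).pow 2)
    have h1 := hcw y hy
    rw [dΦ.fderiv] at h1
    simp [cross_apply, Matrix.vecHead, Matrix.vecTail] at h1
    linear_combination h1
  -- The directions are chosen to isolate one entry of `w` at a time: the quadratic coefficient is
  -- `2 w₂` along `(1, 1, 0)` once terms without `w₂` drop out, and after it `-2 w₀` along `(0, 1,
  -- 1)`; the linear coefficient along `(0, 0, 1)` then gives `w₁`.
  have w2 : w 2 = 0 := by
    have := cubic_coeff_eq_zero_of_eventually
      (a := c 0 + (w 1 * p 2 - w 2 * p 1) + 2 * p 1 * (c 1 + (w 2 * p 0 - w 0 * p 2)))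
      (b := -w 2 + 2 * (c 1 + (w 2 * p 0 - w 0 * p 2)) + 2 * p 1 * w 2) (c := 2 * w 2) (d := 0) (by
        filter_upwards [hoU'.eventually_mem_line hp ![1, 1, 0]] with s hs
        have := key _ hs
        simp at this
        linear_combination this)
    linarith [this.2.2.1]
  have w0 : w 0 = 0 := by
    have := cubic_coeff_eq_zero_of_eventually
      (a := c 0 + (w 1 * p 2 - w 2 * p 1) + 2 * p 1 * (c 1 + (w 2 * p 0 - w 0 * p 2)))
      (b := w 1 - w 2 + 2 * (c 1 + (w 2 * p 0 - w 0 * p 2)) - 2 * p 1 * w 0) (c := -2 * w 0)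
      (d := 0) (by
        filter_upwards [hoU'.eventually_mem_line hp ![0, 1, 1]] with s hs
        have := key _ hs
        simp at this
        linear_combination this)
    linarith [this.2.2.1]
  have w1 : w 1 = 0 := by
    have := cubic_coeff_eq_zero_of_eventually
      (a := c 0 + (w 1 * p 2 - w 2 * p 1) + 2 * p 1 * (c 1 + (w 2 * p 0 - w 0 * p 2)))
      (b := w 1 - 2 * p 1 * w 0) (c := 0) (d := 0) (by
        filter_upwards [hoU'.eventually_mem_line hp ![0, 0, 1]] with s hs
        have := key _ hs
        simp at this
        linear_combination this)
    have h := this.2.1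
    rw [w0] at h
    linarith
  exact hw (by funext i; fin_cases i <;> assumption)

/-! ### The classification -/

theorem corollary1 :
    -- every involutive Noether integral is, up to equivalence, of one of the two forms
    (∀ (Ω : Set Vec3) (A : Vec3 → Vec3) (Φ : Vec3 → ℝ) (X : PointField)
        (I : ℝ → Vec3 → Vec3 → ℝ),
      IsOpen Ω → IsConnected Ω → SmoothPotentials Ω A Φ → InhomogeneousCurved Ω A →
      AdmitsInvolutiveIntegral Ω A Φ X I →
      ∃ (T : EquivTransf) (a b : ℝ), a ≠ 0 ∧
        ((∃ k : ℝ, T.MapsField Ω X (helicalField k) ∧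
            ∀ p ∈ Ω, cylRadius (T.pos p) ≠ 0 →
              ∃ (U : Set Vec3) (J : Vec3 → Vec3 → ℝ), IsOpen U ∧ p ∈ U ∧ U ⊆ Ω ∧
                ReducesToHelical T k U A Φ J ∧
                ∀ (t : ℝ), ∀ x ∈ U, ∀ v : Vec3,
                  I t x v = a * J x v + b * hamiltonian Φ x v) ∨
          (T.MapsField Ω X translationalField ∧
            ∀ p ∈ Ω,
              ∃ (U : Set Vec3) (J : Vec3 → Vec3 → ℝ), IsOpen U ∧ p ∈ U ∧ U ⊆ Ω ∧
                ReducesToTranslational T U A Φ J ∧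
                ∀ (t : ℝ), ∀ x ∈ U, ∀ v : Vec3,
                  I t x v = a * J x v + b * hamiltonian Φ x v))) ∧
    -- every system equivalent to one of the two cases admits the corresponding integral
    (∀ (U : Set Vec3) (A : Vec3 → Vec3) (Φ : Vec3 → ℝ) (T : EquivTransf)
        (J : Vec3 → Vec3 → ℝ),
      IsOpen U → SmoothPotentials U A Φ →
      (∀ k : ℝ, ReducesToHelical T k U A Φ J →
        ∃ X : PointField, T.MapsField U X (helicalField k) ∧
          AdmitsInvolutiveIntegral U A Φ X (fun _ => J)) ∧
      (ReducesToTranslational T U A Φ J →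
        ∃ X : PointField, T.MapsField U X translationalField ∧
          AdmitsInvolutiveIntegral U A Φ X (fun _ => J))) ∧
    -- the two symmetries are inequivalent
    (∀ (k : ℝ) (T : EquivTransf) (U : Set Vec3), IsOpen U → U.Nonempty →
      ¬ T.MapsField U (helicalField k) translationalField) ∧
    -- both cases occur, and neither is contained in the other one
    (∀ k : ℝ, ∃ (U : Set Vec3) (A : Vec3 → Vec3) (Φ : Vec3 → ℝ),
      IsOpen U ∧ IsConnected U ∧ SmoothPotentials U A Φ ∧ InhomogeneousCurved U A ∧
      (∃ T J, ReducesToHelical T k U A Φ J) ∧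
      ∀ U' ⊆ U, IsOpen U' → U'.Nonempty → ¬ ∃ T J, ReducesToTranslational T U' A Φ J) ∧
    (∃ (U : Set Vec3) (A : Vec3 → Vec3) (Φ : Vec3 → ℝ),
      IsOpen U ∧ IsConnected U ∧ SmoothPotentials U A Φ ∧ InhomogeneousCurved U A ∧
      (∃ T J, ReducesToTranslational T U A Φ J) ∧
      ∀ U' ⊆ U, IsOpen U' → U'.Nonempty → ¬ ∃ T k J, ReducesToHelical T k U' A Φ J) := by
  exact ⟨fun _ _ _ _ _ hΩ hc hS _ h => reduces_of_admits hΩ hc hS h,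
    fun _ _ _ _ _ hU hS => ⟨fun _ h => exists_admits_of_helical hU hS h,
      fun h => exists_admits_of_translational hU hS h⟩,
    fun k T _ hU hne => not_mapsField_helical_translational k T hU hne,
    exists_helical_not_translational, exists_translational_not_helical⟩
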